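/- **Setting.** Qubits sit on the sites of a $D$-dimensional periodic hypercubic lattice $G=\prod_{\mu=1}^D\mathbb Z/L_\mu$, $n=|G|$, with the lattice (shortest-path, $\ell_1$) distance. Let $g(\rho)=\sum_i c_i\prod_{j=1}^p\operatorname{tr}(P_{ij}\rho)$ be an $m$-body, degree-$p$ polynomial: a finite sum, $c_i\in\mathbb R$, each $P_{ij}$ a Pauli string of weight at most $m$; put $\|g\|_1=\sum_i|c_i|$. Let $\xi>0$ and let $\mathcal D$ be a probability distribution on $n$-qubit states such that almost every $\rho\sim\mathcal D$ is translation invariant, $T_\mu\rho T_\mu^\dagger=\rho$ for $\mu=1,\dots,D$, and has exponential clustering with correlation length at most $\xi$: $|\langle O_AO_B\rangle-\langle O_A\rangle\langle O_B\rangle|\le\|O_A\|\,\|O_B\|\,e^{-\mathrm{dist}(A,B)/\xi}$ for all observables $O_A,O_B$ acting on nonempty $A,B\subseteq G$ (spectral norms, $\langle X\rangle=\operatorname{tr}(X\rho)$). **Data.** A classical shadow $S_T(\rho)$ of size $T$ consists of the bases $W_i^{(t)}\in\{X,Y,Z\}$ (uniform, independent) and outcomes $o_i^{(t)}=\pm1$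 of Pauli measurements of every qubit of $T$ copies of $\rho$; put $\sigma_i^{(t)}=(3o_i^{(t)}W_i^{(t)}+I)/2$. Let $\mathcal D_S$ be the law of $(S_T(\rho),g(\rho))$ for $\rho\sim\mathcal D$, and let the training set $Z=(x_j,y_j)_{j=1}^N$ have law $\mathcal D_S^N$. **Kernel.** For $\zeta>0$ let $\mathcal A(\zeta)$ be the set of the boxes $A_a(\zeta)=\{b\in G: a_\mu\le b_\mu<a_\mu+\zeta\ \forall\mu\}$ (periodically), $a\in G$. The polynomial GLQK with $h=1$, built from truncated shadow kernels with hyperparameters $\tau,\gamma>0$, is $$k(S,\tilde S)=\frac1{|\mathcal A(\zeta)|}\sum_{A\in\mathcal A(\zeta)}\exp\Big(\frac{\tau}{T^2}\sum_{t,t'=1}^T\prod_{i\in A}\Big[1+\frac{\gamma}{|A|}\operatorname{tr}(\sigma_i^{(t)}\tilde\sigma_i^{(t')})\Big]\Big).$$ Kernel ridge regression with parameters $\lambda,B$ returns $h_Z(x)=\sum_j\alpha_jk(x_j,x)$, where $\alpha\in\mathbb R^N$ minimizes $\frac1{2N}\sum_i(y_i-\sum_j\alpha_jk(x_j,x_i))^2+\lambda\,\alpha^{\mathsf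 T}K\alpha$ subject to $\alpha^{\mathsf T}K\alpha\le B^2$, with $K_{ij}=k(x_i,x_j)$. **Theorem.** Let $0<\epsilon<\|g\|_1$, $\zeta=m\xi\log(2\|g\|_1mp/\epsilon)$, $s=\lceil\zeta\rceil^D$, and assume $2s/\gamma\ge1$ and $mp/\tau\ge1$. Set $B^2=\|g\|_1^2\,(2mps/\tau\gamma)^{mp}$ and $\lambda=\epsilon^2/6B^2$. If $$N\ge\frac{600}{\epsilon^4}\|g\|_1^4\exp(\tau\exp(5\gamma))\Big(\frac{2mps}{\tau\gamma}\Big)^{mp},\qquad T\ge\frac{256}{3\epsilon^2}\|g\|_1^2\,12^m(mp)^2\log\Big[\frac{\|g\|_1^2\,2^{m+5}mp\,(3^{m^2p}+1)^2}{\epsilon^2}\Big],$$ bounds that do not depend on $n$, then the regression problem has a solution for every $Z$, and for every choice of solutions $$\mathbb E_{Z\sim\mathcal D_S^N}\,\mathbb E_{(S,y)\sim\mathcal D_S}\Big[\tfrac12\,(y-h_Z(S))^2\Big]\le\epsilon^2$$ (with all expectations well defined). -/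

import Mathlib

open MeasureTheory ProbabilityTheory
open scoped BigOperators

namespace GLQK

noncomputable section

open scoped ComplexOrder

/-! ### Qubits, Pauli strings, quantum states -/

/-- Operators on the Hilbert space of qubits labelled by `V`, as matrices in the
computational basis. -/
abbrev Op (V : Type) : Type := Matrix (V → Fin 2) (V → Fin 2) ℂ

/-- The tensor product of single-qubit operators. -/
def tensor {V : Type} [Fintype V] (M : V → Matrix (Fin 2) (Fin 2) ℂ) : Op V :=
  Matrix.of fun x y => ∏ i, M i (x i) (y i)

/-- The single-qubit operators `I, X, Y, Z`, labelled by `0, 1, 2, 3`. -/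
def pauli : Fin 4 → Matrix (Fin 2) (Fin 2) ℂ
  | 0 => 1
  | 1 => !![0, 1; 1, 0]
  | 2 => !![0, -Complex.I; Complex.I, 0]
  | 3 => !![1, 0; 0, -1]

/-- The Pauli string with letters `P i`. -/
def pauliString {V : Type} [Fintype V] (P : V → Fin 4) : Op V :=
  tensor fun i => pauli (P i)

/-- The Pauli weight: the number of qubits on which the string is not the identity. -/
def pauliWeight {V : Type} [Fintype V] (P : V → Fin 4) : ℕ :=
  (Finset.univ.filter fun i => P i ≠ 0).card

/-- A quantum state (density matrix) of the qubits labelled by `V`. -/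
structure QState (V : Type) [Fintype V] [DecidableEq V] where
  mat : Op V
  posSemidef : mat.PosSemidef
  trace_eq_one : mat.trace = 1

/-- The σ-algebra on states generated by the matrix entries (the Borel σ-algebra). -/
instance {V : Type} [Fintype V] [DecidableEq V] : MeasurableSpace (QState V) :=
  MeasurableSpace.comap (fun ρ (x y : V → Fin 2) => ρ.mat x y) MeasurableSpace.pi

/-- `tr(P ρ)` for a Pauli string `P` (a real number, since `P` is Hermitian). -/
def pauliExp {V : Type} [Fintype V] [DecidableEq V] (P : V → Fin 4) (ρ : QState V) : ℝ :=
  (Matrix.trace (pauliString P * ρ.mat)).re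

/-- The degree-`p` polynomial `g(ρ) = ∑ i, c i * ∏ j, tr(P i j ρ)`. -/
def polyVal {V : Type} [Fintype V] [DecidableEq V] {p : ℕ} {ι : Type} [Fintype ι]
    (c : ι → ℝ) (P : ι → Fin p → V → Fin 4) (ρ : QState V) : ℝ :=
  ∑ i, c i * ∏ j, pauliExp (P i j) ρ

/-- The `ℓ₁`-norm of the Pauli coefficients. -/
def coeffNorm {ι : Type} [Fintype ι] (c : ι → ℝ) : ℝ := ∑ i, |c i|

/-! ### The periodic lattice, exponential clustering, translation symmetry -/

/-- The sites of the `D`-dimensional periodic lattice with side lengths `L μ`. -/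
abbrev Site {D : ℕ} (L : Fin D → ℕ) : Type := ∀ μ, ZMod (L μ)

/-- The lattice distance (length of a shortest path on the periodic lattice). -/
def siteDist {D : ℕ} {L : Fin D → ℕ} (a b : Site L) : ℕ :=
  ∑ μ, (a μ - b μ).valMinAbs.natAbs

/-- The shortest distance between two (nonempty) sets of sites. -/
def setDist {D : ℕ} {L : Fin D → ℕ} (A B : Finset (Site L)) : ℕ :=
  sInf {d | ∃ a ∈ A, ∃ b ∈ B, d = siteDist a b}

/-- `O` acts on the subsystem `A`, i.e. `O = M ⊗ I` with `M` an operator on `A`. -/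
def ActsOn {V : Type} [Fintype V] [DecidableEq V] (A : Finset V) (O : Op V) : Prop :=
  ∃ M : Op A, ∀ x y : V → Fin 2,
    O x y = if ∀ i, i ∉ A → x i = y i then M (fun i => x i) (fun i => y i) else 0

/-- The spectral norm, i.e. the operator norm for the Euclidean norm. -/
def specNorm {V : Type} [Fintype V] [DecidableEq V] (O : Op V) : ℝ :=
  ‖Matrix.toEuclideanCLM (n := V → Fin 2) (𝕜 := ℂ) O‖

/-- The expectation value `⟨O⟩ = tr(O ρ)`. -/
def expect {V : Type} [Fintype V] [DecidableEq V] (O : Op V) (ρ : QState V) : ℂ :=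
  Matrix.trace (O * ρ.mat)

/-- The exponential clustering property with correlation length at most `ξ`. -/
def HasECP {D : ℕ} {L : Fin D → ℕ} [∀ μ, NeZero (L μ)] (ξ : ℝ) (ρ : QState (Site L)) : Prop :=
  ∀ A B : Finset (Site L), A.Nonempty → B.Nonempty →
    ∀ OA OB : Op (Site L), OA.IsHermitian → OB.IsHermitian → ActsOn A OA → ActsOn B OB →
      ‖expect (OA * OB) ρ - expect OA ρ * expect OB ρ‖
        ≤ specNorm OA * specNorm OB * Real.exp (-(setDist A B : ℝ) / ξ)

/-- The unitary operator that translates every qubit by one site in direction `μ`. -/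
def translationOp {D : ℕ} (L : Fin D → ℕ) [∀ μ, NeZero (L μ)] (μ : Fin D) : Op (Site L) :=
  Matrix.of fun x y => if x = fun a => y (a - Pi.single μ 1) then 1 else 0

/-- Translation symmetry: `T_μ ρ T_μ† = ρ` in every direction `μ`. -/
def TranslationInvariant {D : ℕ} {L : Fin D → ℕ} [∀ μ, NeZero (L μ)]
    (ρ : QState (Site L)) : Prop :=
  ∀ μ, translationOp L μ * ρ.mat * (translationOp L μ).conjTranspose = ρ.mat

/-! ### Classical shadows from random Pauli measurements -/

/-- The record of one measurement round: for every qubit, the Pauli basis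
(`0, 1, 2` for `X, Y, Z`) and the outcome (`true` for `+1`, `false` for `-1`). -/
abbrev Shot (V : Type) : Type := V → Fin 3 × Bool

/-- A classical shadow of size `T`. -/
abbrev Shadow (V : Type) (T : ℕ) : Type := Fin T → Shot V

/-- The outcome `±1`. -/
def sgn (o : Bool) : ℝ := if o then 1 else -1

/-- The measured Pauli operator `W`. -/
def basisOp (w : Fin 3) : Matrix (Fin 2) (Fin 2) ℂ := pauli w.succ

/-- The projector `(I + o W) / 2` on the eigenspace of `W` with eigenvalue `o`. -/
def outcomeProj (r : Fin 3 × Bool) : Matrix (Fin 2) (Fin 2) ℂ :=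
  (1 / 2 : ℂ) • (1 + (sgn r.2 : ℂ) • basisOp r.1)

/-- The single-qubit classical shadow `(3 o W + I) / 2`. -/
def localShadow (r : Fin 3 × Bool) : Matrix (Fin 2) (Fin 2) ℂ :=
  (1 / 2 : ℂ) • ((3 * sgn r.2 : ℂ) • basisOp r.1 + 1)

/-- The probability of the record `s` when each qubit of `ρ` is measured in an independent
uniformly random Pauli basis (Born rule). -/
def shotProb {V : Type} [Fintype V] [DecidableEq V] (ρ : QState V) (s : Shot V) : ℝ :=
  (1 / 3) ^ Fintype.card V * (Matrix.trace (tensor (fun i => outcomeProj (s i)) * ρ.mat)).re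

/-- The probability of a classical shadow: the `T` rounds are independent. -/
def shadowProb {V : Type} [Fintype V] [DecidableEq V] {T : ℕ} (ρ : QState V)
    (S : Shadow V T) : ℝ :=
  ∏ t, shotProb ρ (S t)

/-- Matrix entries are measurable functions of the state. -/
theorem measurable_entry {V : Type} [Fintype V] [DecidableEq V] (x y : V → Fin 2) :
    Measurable fun ρ : QState V => ρ.mat x y := by
  have h : Measurable fun (ρ : QState V) (x y : V → Fin 2) => ρ.mat x y :=
    comap_measurable _
  exact (measurable_pi_apply y).comp ((measurable_pi_apply x).comp h)

/-- Expectation values of fixed operators are measurable functions of the state. -/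
theorem measurable_traceMul {V : Type} [Fintype V] [DecidableEq V] (O : Op V) :
    Measurable fun ρ : QState V => (Matrix.trace (O * ρ.mat)).re := by
  refine Complex.measurable_re.comp ?_
  simp only [Matrix.trace, Matrix.diag, Matrix.mul_apply]
  exact Finset.measurable_sum _ fun x _ => Finset.measurable_sum _ fun y _ =>
    (measurable_entry y x).const_mul _

/-- For a label function `g`, the Markov kernel that sends a state `ρ` to the law of the labelled
classical shadow `(S_T(ρ), g(ρ))`. -/
def labelledShadow {V : Type} [Fintype V] [DecidableEq V] (T : ℕ) {p : ℕ} {ι : Type} [Fintype ι]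
    (c : ι → ℝ) (P : ι → Fin p → V → Fin 4) : Kernel (QState V) (Shadow V T × ℝ) where
  toFun ρ := ∑ S : Shadow V T, ENNReal.ofReal (shadowProb ρ S) • Measure.dirac (S, polyVal c P ρ)
  measurable' := by
    have hg : Measurable fun ρ : QState V => polyVal c P ρ :=
      Finset.measurable_sum _ fun i _ =>
        (Finset.measurable_prod _ fun j _ => measurable_traceMul _).const_mul _
    have hs : ∀ S : Shadow V T, Measurable fun ρ : QState V => shadowProb ρ S := fun S =>
      Finset.measurable_prod _ fun t _ => (measurable_traceMul _).const_mul _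
    refine Measure.measurable_of_measurable_coe _ fun s hs' => ?_
    simp only [Measure.coe_finsetSum, Finset.sum_apply, Measure.smul_apply, smul_eq_mul]
    refine Finset.measurable_sum _ fun S _ => (hs S).ennreal_ofReal.mul ?_
    exact (Measure.measurable_coe hs').comp
      (Measure.measurable_dirac.comp (measurable_const.prodMk hg))

/-- The distribution `𝒟_S` of labelled classical shadows `(S_T(ρ), g(ρ))`: first `ρ ∼ 𝒟`, then
`S_T(ρ)` is generated by random Pauli measurements on `T` copies of `ρ`. -/
def dataDist {V : Type} [Fintype V] [DecidableEq V] (𝒟 : Measure (QState V)) (T : ℕ) {p : ℕ}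
    {ι : Type} [Fintype ι] (c : ι → ℝ) (P : ι → Fin p → V → Fin 4) : Measure (Shadow V T × ℝ) :=
  𝒟.bind (labelledShadow T c P)

/-! ### The polynomial GLQK with the truncated shadow kernel -/

/-- The hypercubic subsystem of real side length `ζ` with corner `a` on the periodic lattice. -/
def box {D : ℕ} {L : Fin D → ℕ} [∀ μ, NeZero (L μ)] (ζ : ℝ) (a : Site L) : Finset (Site L) :=
  Finset.univ.filter fun b => ∀ μ, ((b μ - a μ).val : ℝ) < ζ

/-- The set of local subsystems `𝒜_GL(ζ)`. -/
def localSubsystems {D : ℕ} (L : Fin D → ℕ) [∀ μ, NeZero (L μ)] (ζ : ℝ) :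
    Finset (Finset (Site L)) :=
  Finset.univ.image (box ζ)

/-- The truncated shadow kernel on the subsystem `A` with hyperparameters `τ, γ`. -/
def truncatedShadowKernel {V : Type} {T : ℕ} (τ γ : ℝ) (A : Finset V) (S S' : Shadow V T) : ℝ :=
  Real.exp (τ / (T : ℝ) ^ 2 * ∑ t, ∑ t', ∏ i ∈ A,
    (1 + γ / (A.card : ℝ) * (Matrix.trace (localShadow (S t i) * localShadow (S' t' i))).re))

/-- The polynomial GLQK of degree `h` built from truncated shadow kernels on `𝒜_GL(ζ)`. -/
def polyGLQK {D : ℕ} {L : Fin D → ℕ} [∀ μ, NeZero (L μ)] {T : ℕ} (ζ τ γ : ℝ) (h : ℕ)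
    (S S' : Shadow (Site L) T) : ℝ :=
  (1 / ((localSubsystems L ζ).card : ℝ) *
    ∑ A ∈ localSubsystems L ζ, truncatedShadowKernel τ γ A S S') ^ h

/-! ### Kernel ridge regression -/

/-- The kernel model `h_α(x) = ∑ j, α_j k(x_j, x)` for the training data `Z = (x_j, y_j)_j`. -/
def kernelModel {X : Type} (k : X → X → ℝ) {N : ℕ} (Z : Fin N → X × ℝ) (α : Fin N → ℝ) (x : X) :
    ℝ :=
  ∑ j, α j * k (Z j).1 x

/-- `αᵀ K α`, the squared norm of the dual vector `w = ∑ j, α_j φ(x_j)` in the feature space. -/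
def sqNorm {X : Type} (k : X → X → ℝ) {N : ℕ} (Z : Fin N → X × ℝ) (α : Fin N → ℝ) : ℝ :=
  ∑ i, ∑ j, α i * k (Z i).1 (Z j).1 * α j

/-- The regularized empirical loss `L_Z(w) + lam ‖w‖²`, with the loss `(y - h(x))² / 2`. -/
def regLoss {X : Type} (k : X → X → ℝ) (lam : ℝ) {N : ℕ} (Z : Fin N → X × ℝ) (α : Fin N → ℝ) : ℝ :=
  1 / (N : ℝ) * ∑ i, ((Z i).2 - kernelModel k Z α (Z i).1) ^ 2 / 2 + lam * sqNorm k Z α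

/-- `α` is an output of kernel ridge regression: it minimizes the regularized empirical loss
subject to `αᵀ K α ≤ B²`. -/
def IsKRRSolution {X : Type} (k : X → X → ℝ) (lam Bsq : ℝ) {N : ℕ} (Z : Fin N → X × ℝ)
    (α : Fin N → ℝ) : Prop :=
  sqNorm k Z α ≤ Bsq ∧
    ∀ β : Fin N → ℝ, sqNorm k Z β ≤ Bsq → regLoss k lam Z α ≤ regLoss k lam Z β

/-- The loss `(y - h_α(x))² / 2` of the trained model on a labelled input. -/
def sqLoss {X : Type} (k : X → X → ℝ) {N : ℕ} (Z : Fin N → X × ℝ) (α : Fin N → ℝ) (z : X × ℝ) : ℝ :=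
  (z.2 - kernelModel k Z α z.1) ^ 2 / 2

/-- The expected loss of the trained model over the distribution `μ`. -/
def expectedLoss {X : Type} [MeasurableSpace X] (μ : Measure (X × ℝ)) (k : X → X → ℝ) {N : ℕ}
    (Z : Fin N → X × ℝ) (α : Fin N → ℝ) : ℝ :=
  ∫ z, sqLoss k Z α z ∂μ

end

end GLQK

/-! The label is approximated by a function of the shadow that lies in a ball of the feature space.
Ridge regression constrained to that ball does almost as well as any fixed element of it.

Locality. Put δ = ξ log(2‖g‖₁mp/ε). From the support of a Pauli string of weight at most m one can
repeatedly peel off a cluster of extent less than mδ = ζ at distance at least δ from the remaining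
sites. Exponential clustering factorizes the expectation value at a cost exp(-δ/ξ) per cluster, and
translation invariance moves each factor separately into any prescribed box. Hence each monomial of
g is, up to ε/(2‖g‖₁), a product of Pauli expectation values inside one box, whichever box is chosen
(`exists_list_supported_in_box`). Averaging over the boxes and inserting shadow estimates gives
`localModel`; Hoeffding's inequality controls the replacement (`sum_shadowProb_sq_le_of_size`).

Norm. In Pauli coordinates the kernel of a box is exp(τ ∑ W_Q est_Q(S) est_Q(S')) with nonnegative
W_Q (`truncatedShadowKernel_eq`). In its power series each monomial in the estimates of strings
supported in the box has an explicit positive coefficient, whose inverse bounds the squared norm of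
the monomial. This is stated as an inequality of quadratic forms (`localModel_le_polyGLQK`). Since
there are finitely many shadows, `exists_featureMap_and_dual` turns it into a vector v in a
finite-dimensional feature space with ‖v‖² ≤ B² that represents the local model.

Generalization. Strong convexity makes the constrained minimizer stable in a relative sense: if λN ≥
100 β, with β a bound on k(x,x), replacing a sample changes the prediction there by at most 1/199 of
the residuals involved (`IsBallMin.stability`). Exchangeability then bounds the expected loss by
(201/199)² times the expected training loss, hence by (201/199)² times the regularized loss of v;
the bound on labels serves only for integrability. The loss of v is at most 7ε²/20 and its
regularization at most ε²/6, which leaves ample room below ε². -/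

namespace GLQK

open scoped RealInnerProductSpace

/-! ### Ridge regression in a feature space -/

section Regression

variable {X H : Type} [NormedAddCommGroup H] [InnerProductSpace ℝ H]

/-- The regularized empirical loss of the dual vector `w` in the feature space of `φ`. -/
noncomputable def featureLoss (φ : X → H) (lam : ℝ) {N : ℕ} (Z : Fin N → X × ℝ) (w : H) : ℝ :=
  1 / (N : ℝ) * ∑ i, ((Z i).2 - ⟪w, φ (Z i).1⟫) ^ 2 / 2 + lam * ‖w‖ ^ 2

/-- The dual vector `∑ j, α j φ(x_j)`. -/
noncomputable def dualVector (φ : X → H) {N : ℕ} (Z : Fin N → X × ℝ) (α : Fin N → ℝ) : H :=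
  ∑ j, α j • φ (Z j).1

variable {k : X → X → ℝ} {φ : X → H} (hk : ∀ x y, k x y = ⟪φ x, φ y⟫) {N : ℕ}

include hk in
theorem kernelModel_eq_inner (Z : Fin N → X × ℝ) (α : Fin N → ℝ) (x : X) :
    kernelModel k Z α x = ⟪dualVector φ Z α, φ x⟫ := by
  simp [kernelModel, dualVector, sum_inner, real_inner_smul_left, hk]

include hk in
theorem sqNorm_eq_norm_sq (Z : Fin N → X × ℝ) (α : Fin N → ℝ) :
    sqNorm k Z α = ‖dualVector φ Z α‖ ^ 2 := by
  rw [← real_inner_self_eq_norm_sq]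
  simp only [sqNorm, dualVector, sum_inner, inner_sum, real_inner_smul_left,
    real_inner_smul_right, hk]
  exact Finset.sum_congr rfl fun i _ => Finset.sum_congr rfl fun j _ => by
    rw [real_inner_comm]
    ring

include hk in
theorem regLoss_eq_featureLoss (lam : ℝ) (Z : Fin N → X × ℝ) (α : Fin N → ℝ) :
    regLoss k lam Z α = featureLoss φ lam Z (dualVector φ Z α) := by
  simp only [regLoss, featureLoss, kernelModel_eq_inner hk, sqNorm_eq_norm_sq hk]

theorem exists_dualVector_of_mem_span (Z : Fin N → X × ℝ) {v : H}
    (hv : v ∈ Submodule.span ℝ (Set.range fun j => φ (Z j).1)) : ∃ α, dualVector φ Z α = v :=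
  (Submodule.mem_span_range_iff_exists_fun ℝ).1 hv

/-- Every vector can be replaced by a dual vector of the training data with the same predictions
on the training data and a smaller norm. -/
theorem exists_dualVector_projection (Z : Fin N → X × ℝ) (w : H) :
    ∃ α, ‖dualVector φ Z α‖ ≤ ‖w‖ ∧
      ∀ j, ⟪dualVector φ Z α, φ (Z j).1⟫ = ⟪w, φ (Z j).1⟫ := by
  set W := Submodule.span ℝ (Set.range fun j => φ (Z j).1) with hW
  have : FiniteDimensional ℝ W := FiniteDimensional.span_of_finite ℝ (Set.finite_range _)
  obtain ⟨α, hα⟩ := exists_dualVector_of_mem_span Z (W.starProjection_apply_mem w)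
  refine ⟨α, ?_, fun j => ?_⟩
  · rw [hα]
    exact W.norm_starProjection_apply_le w
  · have hmem : φ (Z j).1 ∈ W := Submodule.subset_span ⟨j, rfl⟩
    rw [hα, Submodule.inner_starProjection_left_eq_right,
      Submodule.starProjection_eq_self_iff.2 hmem]

-- The loss is continuous on the compact intersection of the ball with the span of the training
-- features, and every point of that span is a dual vector. The coefficients themselves need not be
-- bounded, as the Gram matrix may be singular.
include hk in
theorem exists_isKRRSolution [FiniteDimensional ℝ H] {lam Bsq : ℝ} (hB : 0 ≤ Bsq)
    (Z : Fin N → X × ℝ) : ∃ α, IsKRRSolution k lam Bsq Z α := by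
  set W := Submodule.span ℝ (Set.range fun j => φ (Z j).1)
  have hcomp : IsCompact ((W : Set H) ∩ Metric.closedBall 0 (Real.sqrt Bsq)) :=
    (isCompact_closedBall _ _).inter_left W.closed_of_finiteDimensional
  have hcont : Continuous (featureLoss φ lam Z) := by
    unfold featureLoss
    fun_prop
  obtain ⟨w, hw, hmin⟩ := hcomp.exists_isMinOn
    (Set.nonempty_of_mem (x := 0) ⟨W.zero_mem, by simp⟩) hcont.continuousOn
  have hball : ∀ v : H, v ∈ Metric.closedBall 0 (Real.sqrt Bsq) ↔ ‖v‖ ^ 2 ≤ Bsq := fun v => by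
    rw [mem_closedBall_zero_iff, Real.le_sqrt (norm_nonneg _) hB]
  obtain ⟨α, rfl⟩ := exists_dualVector_of_mem_span Z hw.1
  refine ⟨α, ?_, fun β hβ => ?_⟩
  · rw [sqNorm_eq_norm_sq hk]
    exact (hball _).1 hw.2
  · rw [regLoss_eq_featureLoss hk, regLoss_eq_featureLoss hk]
    refine hmin ⟨Submodule.sum_mem _ fun j _ => Submodule.smul_mem _ _
      (Submodule.subset_span ⟨j, rfl⟩), (hball _).2 ?_⟩
    rwa [← sqNorm_eq_norm_sq hk]

/-- The dual vector of a solution minimizes the regularized loss over the ball. -/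
def IsBallMin (φ : X → H) (lam Bsq : ℝ) (Z : Fin N → X × ℝ) (w : H) : Prop :=
  ‖w‖ ^ 2 ≤ Bsq ∧ ∀ v : H, ‖v‖ ^ 2 ≤ Bsq → featureLoss φ lam Z w ≤ featureLoss φ lam Z v

-- Representer theorem: projecting a competitor onto the span of the training features keeps its
-- predictions there and does not increase its norm.
include hk in
theorem IsKRRSolution.isBallMin {lam Bsq : ℝ} (hlam : 0 ≤ lam) {Z : Fin N → X × ℝ}
    {α : Fin N → ℝ} (h : IsKRRSolution k lam Bsq Z α) :
    IsBallMin φ lam Bsq Z (dualVector φ Z α) := by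
  refine ⟨by rw [← sqNorm_eq_norm_sq hk]; exact h.1, fun v hv => ?_⟩
  obtain ⟨β, hβ, hp⟩ := exists_dualVector_projection (φ := φ) Z v
  have hsq : ‖dualVector φ Z β‖ ^ 2 ≤ ‖v‖ ^ 2 := pow_le_pow_left₀ (norm_nonneg _) hβ 2
  have := h.2 β (by rw [sqNorm_eq_norm_sq hk]; exact hsq.trans hv)
  rw [regLoss_eq_featureLoss hk, regLoss_eq_featureLoss hk] at this
  refine this.trans ?_
  simp only [featureLoss, hp]
  gcongr

/-- An exact second-order expansion; the quadratic coefficient is at least lam‖d‖², the source of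
strong convexity. -/
theorem featureLoss_add_smul (lam : ℝ) (Z : Fin N → X × ℝ) (w d : H) (t : ℝ) :
    featureLoss φ lam Z (w + t • d) = featureLoss φ lam Z w
      + t * (2 * lam * ⟪w, d⟫ - 1 / (N : ℝ) * ∑ i, ((Z i).2 - ⟪w, φ (Z i).1⟫) * ⟪d, φ (Z i).1⟫)
      + t ^ 2 * (lam * ‖d‖ ^ 2 + 1 / (N : ℝ) * ∑ i, ⟪d, φ (Z i).1⟫ ^ 2 / 2) := by
  have h1 : ‖w + t • d‖ ^ 2 = ‖w‖ ^ 2 + 2 * t * ⟪w, d⟫ + t ^ 2 * ‖d‖ ^ 2 := by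
    rw [norm_add_sq_real, real_inner_smul_right, norm_smul, mul_pow, Real.norm_eq_abs, sq_abs]
    ring
  have h2 : ∑ i, ((Z i).2 - ⟪w + t • d, φ (Z i).1⟫) ^ 2 / 2
      = ∑ i, ((Z i).2 - ⟪w, φ (Z i).1⟫) ^ 2 / 2
        - t * ∑ i, ((Z i).2 - ⟪w, φ (Z i).1⟫) * ⟪d, φ (Z i).1⟫
        + t ^ 2 * ∑ i, ⟪d, φ (Z i).1⟫ ^ 2 / 2 := by
    rw [Finset.mul_sum, Finset.mul_sum, ← Finset.sum_sub_distrib, ← Finset.sum_add_distrib]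
    refine Finset.sum_congr rfl fun i _ => ?_
    rw [inner_add_left, real_inner_smul_left]
    ring
  rw [featureLoss, featureLoss, h1, h2]
  ring

/-- Strong convexity of the regularized loss at the constrained minimizer. -/
theorem IsBallMin.add_sq_le {lam Bsq : ℝ} (hlam : 0 ≤ lam) {Z : Fin N → X × ℝ} {w v : H}
    (h : IsBallMin φ lam Bsq Z w) (hv : ‖v‖ ^ 2 ≤ Bsq) :
    featureLoss φ lam Z w + lam * ‖v - w‖ ^ 2 ≤ featureLoss φ lam Z v := by
  have hB : 0 ≤ Bsq := (sq_nonneg _).trans hv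
  set l := 2 * lam * ⟪w, v - w⟫
    - 1 / (N : ℝ) * ∑ i, ((Z i).2 - ⟪w, φ (Z i).1⟫) * ⟪v - w, φ (Z i).1⟫ with hl
  set s := 1 / (N : ℝ) * ∑ i, ⟪v - w, φ (Z i).1⟫ ^ 2 / 2
  have hs : 0 ≤ s := mul_nonneg (by positivity) (Finset.sum_nonneg fun i _ => by positivity)
  have key : ∀ t : ℝ, 0 < t → t ≤ 1 → 0 ≤ l + t * (lam * ‖v - w‖ ^ 2 + s) := by
    intro t ht0 ht1
    have hmem : ‖w + t • (v - w)‖ ^ 2 ≤ Bsq := by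
      have h1 : ∀ u : H, ‖u‖ ^ 2 ≤ Bsq ↔ u ∈ Metric.closedBall (0 : H) (Real.sqrt Bsq) :=
        fun u => by rw [mem_closedBall_zero_iff, Real.le_sqrt (norm_nonneg _) hB]
      have := (convex_closedBall (0 : H) (Real.sqrt Bsq)).add_smul_sub_mem ((h1 w).1 h.1)
        ((h1 v).1 hv) ⟨ht0.le, ht1⟩
      exact (h1 _).2 this
    have h2 := h.2 _ hmem
    rw [featureLoss_add_smul] at h2
    have h3 : 0 ≤ t * (l + t * (lam * ‖v - w‖ ^ 2 + s)) := by linarith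
    exact nonneg_of_mul_nonneg_right h3 ht0
  have hl0 : 0 ≤ l := by
    by_contra! hneg
    set q := lam * ‖v - w‖ ^ 2 + s
    have hq : 0 ≤ q := by positivity
    -- The minimizer may lie on the boundary of the ball, so only l ≥ 0 can be expected. If l < 0,
    -- this t makes the quadratic term at most -l/2, too small to compensate for l.
    have := key (min 1 (-l / (2 * (q + 1)))) (lt_min one_pos (by apply div_pos <;> linarith))
      (min_le_left _ _)
    have h4 : min 1 (-l / (2 * (q + 1))) * q ≤ -l / 2 := by
      calc min 1 (-l / (2 * (q + 1))) * q ≤ -l / (2 * (q + 1)) * (q + 1) :=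
            mul_le_mul (min_le_right _ _) (by linarith) hq
              (div_nonneg (by linarith) (by positivity))
        _ = -l / 2 := by field_simp
    linarith
  have h5 := featureLoss_add_smul (φ := φ) lam Z w (v - w) 1
  rw [one_smul, add_sub_cancel] at h5
  rw [h5]
  change _ ≤ _ + 1 * l + 1 ^ 2 * (lam * ‖v - w‖ ^ 2 + s)
  linarith

theorem IsBallMin.eq {lam Bsq : ℝ} (hlam : 0 < lam) {Z : Fin N → X × ℝ} {w v : H}
    (hw : IsBallMin φ lam Bsq Z w) (hv : IsBallMin φ lam Bsq Z v) : w = v := by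
  have h1 := hw.add_sq_le hlam.le hv.1
  have h2 := hv.2 w hw.1
  have h3 : lam * ‖v - w‖ ^ 2 ≤ 0 := by linarith
  have h4 : ‖v - w‖ = 0 := by
    by_contra hne
    have : 0 < ‖v - w‖ := lt_of_le_of_ne (norm_nonneg _) (Ne.symm hne)
    have : 0 < lam * ‖v - w‖ ^ 2 := by positivity
    linarith
  exact (sub_eq_zero.1 (norm_eq_zero.1 h4)).symm

theorem abs_inner_feature_le {β : ℝ} (hβ : ∀ x, ‖φ x‖ ^ 2 ≤ β) (u : H) (x : X) :
    |⟪u, φ x⟫| ≤ Real.sqrt β * ‖u‖ := by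
  refine (abs_real_inner_le_norm _ _).trans ?_
  rw [mul_comm]
  gcongr
  exact Real.le_sqrt_of_sq_le (hβ x)

/-- The constrained minimizer is a Lipschitz function of the labels. -/
theorem IsBallMin.norm_sub_le {lam Bsq β : ℝ} (hlam : 0 < lam) (hβ : ∀ x, ‖φ x‖ ^ 2 ≤ β)
    {x : Fin N → X} {y y' : Fin N → ℝ} {w w' : H}
    (hw : IsBallMin φ lam Bsq (fun i => (x i, y i)) w)
    (hw' : IsBallMin φ lam Bsq (fun i => (x i, y' i)) w') :
    ‖w' - w‖ ≤ Real.sqrt β / (2 * lam) * ∑ i, |y' i - y i| := by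
  rcases Nat.eq_zero_or_pos N with rfl | hN
  · have h1 := hw.eq hlam (v := w') (by convert hw')
    simp [h1]
  have h1 := hw.add_sq_le hlam.le hw'.1
  have h2 := hw'.add_sq_le hlam.le hw.1
  rw [norm_sub_rev w w'] at h2
  simp only [featureLoss] at h1 h2
  -- Adding the two strong convexity inequalities cancels the squares of the predictions and leaves
  -- only the differences of the labels.
  have h3 : 2 * lam * ‖w' - w‖ ^ 2 ≤ 1 / (N : ℝ) * ∑ i, (y' i - y i) * ⟪w' - w, φ (x i)⟫ := by
    have : ∑ i, (y' i - y i) * ⟪w' - w, φ (x i)⟫ =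
        ∑ i, (y i - ⟪w', φ (x i)⟫) ^ 2 / 2 + ∑ i, (y' i - ⟪w, φ (x i)⟫) ^ 2 / 2
        - ∑ i, (y i - ⟪w, φ (x i)⟫) ^ 2 / 2 - ∑ i, (y' i - ⟪w', φ (x i)⟫) ^ 2 / 2 := by
      rw [← Finset.sum_add_distrib, ← Finset.sum_sub_distrib, ← Finset.sum_sub_distrib]
      refine Finset.sum_congr rfl fun i _ => ?_
      rw [inner_sub_left]
      ring
    rw [this, mul_sub, mul_sub, mul_add]
    linarith
  have h4 : 1 / (N : ℝ) * ∑ i, (y' i - y i) * ⟪w' - w, φ (x i)⟫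
      ≤ 1 * ((∑ i, |y' i - y i|) * (Real.sqrt β * ‖w' - w‖)) := by
    have hN1 : (1 : ℝ) / N ≤ 1 := by
      rw [div_le_one (by exact_mod_cast hN)]
      exact_mod_cast hN
    have h5 : ∑ i, (y' i - y i) * ⟪w' - w, φ (x i)⟫
        ≤ (∑ i, |y' i - y i|) * (Real.sqrt β * ‖w' - w‖) := by
      rw [Finset.sum_mul]
      refine Finset.sum_le_sum fun i _ => (le_abs_self _).trans ?_
      rw [abs_mul]
      gcongr
      exact abs_inner_feature_le hβ _ _
    calc _ ≤ 1 / (N : ℝ) * ((∑ i, |y' i - y i|) * (Real.sqrt β * ‖w' - w‖)) := by gcongr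
      _ ≤ _ := by gcongr
  rw [one_mul] at h4
  rcases (norm_nonneg (w' - w)).eq_or_lt with h0 | h0
  · rw [← h0]
    positivity
  · have h6 : 2 * lam * ‖w' - w‖ ≤ (∑ i, |y' i - y i|) * Real.sqrt β := by
      refine le_of_mul_le_mul_right ?_ h0
      nlinarith
    rw [div_mul_eq_mul_div, le_div_iff₀ (by positivity)]
    linarith

/-- Replace-one stability of constrained ridge regression. -/
theorem IsBallMin.stability {lam Bsq β : ℝ} (hβ0 : 0 < β) (hβ : ∀ x, ‖φ x‖ ^ 2 ≤ β)
    (hN : 0 < N) (hlam : 100 * β ≤ lam * N) {Z Z' : Fin N → X × ℝ} {i : Fin N}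
    (hZ : ∀ j, j ≠ i → Z j = Z' j) {w w' : H}
    (hw : IsBallMin φ lam Bsq Z w) (hw' : IsBallMin φ lam Bsq Z' w') :
    |⟪w' - w, φ (Z i).1⟫| ≤ 1 / 199 * (|(Z i).2 - ⟪w, φ (Z i).1⟫|
      + |(Z' i).2 - ⟪w', φ (Z' i).1⟫|) := by
  have hN' : (0 : ℝ) < N := by exact_mod_cast hN
  have hlam0 : 0 < lam := by
    by_contra! hneg
    nlinarith
  have h1 := hw.add_sq_le hlam0.le hw'.1
  have h2 := hw'.add_sq_le hlam0.le hw.1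
  rw [norm_sub_rev w w'] at h2
  simp only [featureLoss] at h1 h2
  have hsum : ∀ v : H, ∑ j, ((Z j).2 - ⟪v, φ (Z j).1⟫) ^ 2 / 2
      - ∑ j, ((Z' j).2 - ⟪v, φ (Z' j).1⟫) ^ 2 / 2
      = ((Z i).2 - ⟪v, φ (Z i).1⟫) ^ 2 / 2 - ((Z' i).2 - ⟪v, φ (Z' i).1⟫) ^ 2 / 2 := by
    intro v
    rw [← Finset.sum_sub_distrib]
    refine Finset.sum_eq_single i (fun j _ hj => ?_) (by simp)
    rw [hZ j hj, sub_self]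
  have hs1 := hsum w
  have hs2 := hsum w'
  set u := w' - w with hu
  have hw'' : w' = w + u := by rw [hu]; abel
  set r := (Z i).2 - ⟪w, φ (Z i).1⟫ with hr
  set r' := (Z' i).2 - ⟪w', φ (Z' i).1⟫ with hr'
  set b := ⟪u, φ (Z i).1⟫ with hb
  set b' := ⟪u, φ (Z' i).1⟫ with hb'
  have e1 : (Z i).2 - ⟪w', φ (Z i).1⟫ = r - b := by
    rw [hr, hb, hw'', inner_add_left]; ring
  have e2 : (Z' i).2 - ⟪w, φ (Z' i).1⟫ = r' + b' := by
    rw [hr', hb', hw'', inner_add_left]; ring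
  rw [e2] at hs1
  rw [e1] at hs2
  -- In the sum of the two strong convexity inequalities all samples but the i-th cancel. Here r, r'
  -- are the residuals on the exchanged samples and b, b' the changes of the predictions there.
  have h3 : 2 * lam * ‖u‖ ^ 2 ≤ 1 / (N : ℝ) * (-r * b + b ^ 2 / 2 + r' * b' + b' ^ 2 / 2) := by
    have : -r * b + b ^ 2 / 2 + r' * b' + b' ^ 2 / 2 =
        ((r - b) ^ 2 / 2 - r' ^ 2 / 2) - (r ^ 2 / 2 - (r' + b') ^ 2 / 2) := by ring
    rw [this, ← hs1, ← hs2, mul_sub, mul_sub, mul_sub]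
    linarith
  have hbb := abs_inner_feature_le hβ u (Z i).1
  have hbb' := abs_inner_feature_le hβ u (Z' i).1
  rw [← hb] at hbb
  rw [← hb'] at hbb'
  have hx0 : 0 ≤ Real.sqrt β * ‖u‖ := by positivity
  have hxsq : (Real.sqrt β * ‖u‖) ^ 2 = β * ‖u‖ ^ 2 := by rw [mul_pow, Real.sq_sqrt hβ0.le]
  set ξ := Real.sqrt β * ‖u‖ with hξ
  refine hbb.trans ?_
  have h4 : 2 * lam * N * ‖u‖ ^ 2 ≤ (|r| + |r'|) * ξ + ξ ^ 2 := by
    have h5 : 2 * lam * N * ‖u‖ ^ 2 ≤ -r * b + b ^ 2 / 2 + r' * b' + b' ^ 2 / 2 := by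
      rw [one_div, inv_mul_eq_div, le_div_iff₀ hN'] at h3
      linarith
    have h6 : -r * b ≤ |r| * ξ := by
      calc -r * b ≤ |-r * b| := le_abs_self _
        _ = |r| * |b| := by rw [abs_mul, abs_neg]
        _ ≤ |r| * ξ := by gcongr
    have h7 : r' * b' ≤ |r'| * ξ := by
      calc r' * b' ≤ |r' * b'| := le_abs_self _
        _ = |r'| * |b'| := by rw [abs_mul]
        _ ≤ |r'| * ξ := by gcongr
    have h8 : b ^ 2 ≤ ξ ^ 2 := sq_le_sq' (by linarith [abs_le.1 hbb]) (abs_le.1 hbb).2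
    have h9 : b' ^ 2 ≤ ξ ^ 2 := sq_le_sq' (by linarith [abs_le.1 hbb']) (abs_le.1 hbb').2
    linarith
  have h10 : 199 * ξ ^ 2 ≤ (|r| + |r'|) * ξ := by
    have : 200 * ξ ^ 2 ≤ 2 * lam * N * ‖u‖ ^ 2 := by
      rw [hxsq]
      nlinarith [sq_nonneg ‖u‖]
    linarith
  rcases hx0.eq_or_lt with h0 | h0
  · rw [← h0]
    positivity
  · have : 199 * ξ ≤ |r| + |r'| := le_of_mul_le_mul_right (by nlinarith) h0
    linarith

end Regression

end GLQK

namespace GLQK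

open scoped RealInnerProductSpace

/-! ### Measurability, exchangeability and the expected loss of ridge regression -/

section ExpectedLoss

variable {X H : Type} [NormedAddCommGroup H] [InnerProductSpace ℝ H] [Finite X]
  [MeasurableSpace X] [MeasurableSingletonClass X] {φ : X → H} {N : ℕ}

/-- The squared loss of the dual vector `w`. -/
noncomputable def dualLoss (φ : X → H) (w : H) (z : X × ℝ) : ℝ := (z.2 - ⟪w, φ z.1⟫) ^ 2 / 2

omit [Finite X] [MeasurableSpace X] [MeasurableSingletonClass X] in
theorem dualLoss_nonneg (w : H) (z : X × ℝ) : 0 ≤ dualLoss φ w z := by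
  unfold dualLoss
  positivity

omit [Finite X] [MeasurableSpace X] [MeasurableSingletonClass X] in
theorem dualLoss_le {β Bsq M : ℝ} (hβ : ∀ x, ‖φ x‖ ^ 2 ≤ β) {w : H} (hw : ‖w‖ ^ 2 ≤ Bsq)
    {z : X × ℝ} (hz : |z.2| ≤ M) :
    dualLoss φ w z ≤ (M + Real.sqrt β * Real.sqrt Bsq) ^ 2 / 2 := by
  have h1 : |z.2 - ⟪w, φ z.1⟫| ≤ M + Real.sqrt β * Real.sqrt Bsq := by
    refine (abs_sub _ _).trans (add_le_add hz ((abs_inner_feature_le hβ w z.1).trans ?_))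
    gcongr
    exact Real.le_sqrt_of_sq_le hw
  have h2 := pow_le_pow_left₀ (abs_nonneg _) h1 2
  rw [sq_abs] at h2
  unfold dualLoss
  linarith

theorem measurable_dualLoss (w : H) : Measurable (dualLoss φ w) := by
  have : Measurable fun z : X × ℝ => ⟪w, φ z.1⟫ :=
    (measurable_of_finite fun x => ⟪w, φ x⟫).comp measurable_fst
  exact ((measurable_snd.sub this).pow_const 2).div_const 2

variable {lam Bsq β : ℝ} {w : (Fin N → X × ℝ) → H}

/-- Nothing measurable is assumed about the choice of solutions. For fixed inputs the minimizer is
Lipschitz in the labels, and there are only finitely many inputs. -/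
theorem measurable_inner_ballMin (hlam : 0 < lam) (hβ : ∀ x, ‖φ x‖ ^ 2 ≤ β)
    (hw : ∀ Z, IsBallMin φ lam Bsq Z (w Z)) (x : X) : Measurable fun Z => ⟪w Z, φ x⟫ := by
  set e := MeasurableEquiv.arrowProdEquivProdArrow X ℝ (Fin N)
  suffices h : Measurable fun p : (Fin N → X) × (Fin N → ℝ) => ⟪w (e.symm p), φ x⟫ by
    have h2 := h.comp e.measurable
    convert h2 using 2 with Z
    simp
  refine measurable_from_prod_countable_right fun xs => Continuous.measurable ?_
  refine Continuous.inner (continuous_iff_continuousAt.2 fun y => ?_) continuous_const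
  rw [ContinuousAt, tendsto_iff_norm_sub_tendsto_zero]
  refine squeeze_zero (fun _ => norm_nonneg _) (fun y' =>
    IsBallMin.norm_sub_le hlam hβ (x := xs) (hw (fun i => (xs i, y i)))
      (hw (fun i => (xs i, y' i)))) ?_
  have : Continuous fun y' : Fin N → ℝ => Real.sqrt β / (2 * lam) * ∑ i, |y' i - y i| := by
    fun_prop
  have h3 := this.tendsto y
  simpa using h3

theorem measurable_dualLoss_ballMin (hlam : 0 < lam) (hβ : ∀ x, ‖φ x‖ ^ 2 ≤ β)
    (hw : ∀ Z, IsBallMin φ lam Bsq Z (w Z)) :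
    Measurable fun p : (Fin N → X × ℝ) × (X × ℝ) => dualLoss φ (w p.1) p.2 := by
  have h1 : Measurable fun q : (Fin N → X × ℝ) × X => ⟪w q.1, φ q.2⟫ :=
    measurable_from_prod_countable_left fun x => measurable_inner_ballMin hlam hβ hw x
  have h2 : Measurable fun p : (Fin N → X × ℝ) × (X × ℝ) => ⟪w p.1, φ p.2.1⟫ :=
    h1.comp (measurable_fst.prodMk (measurable_fst.comp measurable_snd))
  exact (((measurable_snd.comp measurable_snd).sub h2).pow_const 2).div_const 2

variable {μ : Measure (X × ℝ)} [IsProbabilityMeasure μ] {M : ℝ}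

theorem integrable_dualLoss (hβ : ∀ x, ‖φ x‖ ^ 2 ≤ β) (hM : ∀ᵐ z ∂μ, |z.2| ≤ M) {v : H}
    (hv : ‖v‖ ^ 2 ≤ Bsq) : Integrable (dualLoss φ v) μ := by
  refine Integrable.of_bound (measurable_dualLoss v).aestronglyMeasurable
    ((M + Real.sqrt β * Real.sqrt Bsq) ^ 2 / 2) (hM.mono fun z hz => ?_)
  rw [Real.norm_of_nonneg (dualLoss_nonneg _ _)]
  exact dualLoss_le hβ hv hz

/-- Convexity of the square, with weights 200/199 and 1/199 of total mass 201/199. In the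
application a is the old residual, c the change of the prediction and b the residual on the
exchanged sample. -/
theorem stability_pointwise {a b c : ℝ} (h : |c| ≤ 1 / 199 * (|a| + |b|)) :
    (a - c) ^ 2 / 2 ≤ 201 / 199 * (200 / 199 * (a ^ 2 / 2) + 1 / 199 * (b ^ 2 / 2)) := by
  have h1 : |a - c| ≤ 200 / 199 * |a| + 1 / 199 * |b| := by
    have := abs_sub a c
    linarith
  have h2 := pow_le_pow_left₀ (abs_nonneg _) h1 2
  rw [sq_abs] at h2
  nlinarith [sq_nonneg (|a| - |b|), sq_abs a, sq_abs b]

theorem measurePreserving_comp_perm {ι : Type} [Fintype ι] {α : Type} [MeasurableSpace α]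
    (ν : Measure α) [SigmaFinite ν] (σ : Equiv.Perm ι) :
    MeasurePreserving (fun f : ι → α => f ∘ σ) (Measure.pi fun _ => ν) (Measure.pi fun _ => ν) := by
  have h := measurePreserving_piCongrLeft (fun _ : ι => ν) σ.symm
  convert h using 2 with f
  ext i
  simp [MeasurableEquiv.piCongrLeft, Equiv.piCongrLeft, Equiv.piCongrLeft']

theorem measurePreserving_tail {α : Type} [MeasurableSpace α] (ν : Measure α)
    [IsProbabilityMeasure ν] (N : ℕ) :
    MeasurePreserving (fun f : Fin (N + 1) → α => fun i => f (Fin.succ i))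
      (Measure.pi fun _ => ν) (Measure.pi fun _ => ν) := by
  have h := (measurePreserving_snd (μ := ν) (ν := Measure.pi fun _ : Fin N => ν)).comp
    (measurePreserving_piFinSuccAbove (fun _ : Fin (N + 1) => ν) 0)
  exact h

/-- The expected loss of constrained ridge regression is at most slightly larger than the
regularized loss of any competitor in the ball. -/
theorem integral_dualLoss_ballMin_le (hβ0 : 0 < β) (hβ : ∀ x, ‖φ x‖ ^ 2 ≤ β) (hN : 0 < N)
    (hlam : 100 * β ≤ lam * N) (hM : ∀ᵐ z ∂μ, |z.2| ≤ M)
    (hw : ∀ Z, IsBallMin φ lam Bsq Z (w Z)) {v : H} (hv : ‖v‖ ^ 2 ≤ Bsq) :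
    Integrable (fun Z => ∫ z, dualLoss φ (w Z) z ∂μ) (Measure.pi fun _ : Fin N => μ) ∧
    ∫ Z, ∫ z, dualLoss φ (w Z) z ∂μ ∂(Measure.pi fun _ : Fin N => μ)
      ≤ (201 / 199) ^ 2 * (∫ z, dualLoss φ v z ∂μ + lam * ‖v‖ ^ 2) := by
  have hN' : (0 : ℝ) < N := by exact_mod_cast hN
  have hlam0 : 0 < lam := by
    by_contra! hneg
    nlinarith
  have hmeas := measurable_dualLoss_ballMin hlam0 hβ hw
  set π := Measure.pi fun _ : Fin N => μ with hπ
  set ν := Measure.pi fun _ : Fin (N + 1) => μ with hν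
  set K := (M + Real.sqrt β * Real.sqrt Bsq) ^ 2 / 2
  have heval : ∀ (n : ℕ) (i : Fin n), ∀ᵐ Z ∂(Measure.pi fun _ : Fin n => μ), |(Z i).2| ≤ M :=
    fun n i => (measurePreserving_eval (fun _ : Fin n => μ) i).quasiMeasurePreserving.ae hM
  have hprod : Integrable (fun p : (X × ℝ) × (Fin N → X × ℝ) => dualLoss φ (w p.2) p.1)
      (μ.prod π) := by
    refine Integrable.of_bound (hmeas.comp measurable_swap).aestronglyMeasurable K ?_
    filter_upwards [Measure.quasiMeasurePreserving_fst.ae hM] with p hp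
    rw [Real.norm_of_nonneg (dualLoss_nonneg _ _)]
    exact dualLoss_le hβ (hw _).1 hp
  refine ⟨hprod.integral_prod_right, ?_⟩
  have hsplit := measurePreserving_piFinSuccAbove (fun _ : Fin (N + 1) => μ) 0
  -- Ghost sample: among N + 1 independent samples, number 0 is the test point and the others are
  -- the training set. `F` is the test loss and `G j` the loss on a training point.
  set F : (Fin (N + 1) → X × ℝ) → ℝ := fun Z => dualLoss φ (w fun i => Z i.succ) (Z 0) with hF
  set G : Fin N → (Fin (N + 1) → X × ℝ) → ℝ :=
    fun j Z => dualLoss φ (w fun i => Z i.succ) (Z j.succ) with hG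
  have hexp : ∫ Z, ∫ z, dualLoss φ (w Z) z ∂μ ∂π = ∫ Z, F Z ∂ν := by
    rw [← integral_prod_symm _ hprod, ← hsplit.integral_comp']
    rfl
  have hFi : Integrable F ν := hsplit.integrable_comp_of_integrable hprod
  have htail : Measurable fun (Z : Fin (N + 1) → X × ℝ) (i : Fin N) => Z i.succ := by fun_prop
  have hGi : ∀ j, Integrable (G j) ν := fun j => by
    refine Integrable.of_bound
      (hmeas.comp (htail.prodMk (measurable_pi_apply j.succ))).aestronglyMeasurable K ?_
    filter_upwards [heval _ j.succ] with Z hZ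
    rw [Real.norm_of_nonneg (dualLoss_nonneg _ _)]
    exact dualLoss_le hβ (hw _).1 hZ
  have hstab : ∀ j, ∫ Z, F Z ∂ν ≤ (201 / 199) ^ 2 * ∫ Z, G j Z ∂ν := by
    intro j
    -- The swap preserves the law and replaces exactly one training sample. After it the test point
    -- is the old training sample j, where stability compares the new predictor with the old one.
    set σ : Equiv.Perm (Fin (N + 1)) := Equiv.swap 0 j.succ with hσ
    have hperm := measurePreserving_comp_perm μ σ
    have hemb : MeasurableEmbedding fun f : Fin (N + 1) → X × ℝ => f ∘ σ := by
      have : (fun f : Fin (N + 1) → X × ℝ => f ∘ σ)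
          = MeasurableEquiv.piCongrLeft (fun _ => X × ℝ) σ.symm := by
        ext1 f
        ext1 i
        simp [MeasurableEquiv.piCongrLeft, Equiv.piCongrLeft, Equiv.piCongrLeft']
      rw [this]
      exact MeasurableEquiv.measurableEmbedding _
    have hpt : ∀ Z, F (Z ∘ σ) ≤ 201 / 199 * (200 / 199 * G j Z + 1 / 199 * G j (Z ∘ σ)) := by
      intro Z
      have hne : ∀ i, i ≠ j → (fun i : Fin N => Z i.succ) i = (fun i : Fin N => (Z ∘ σ) i.succ) i := by
        intro i hi
        simp only [Function.comp_apply, hσ]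
        rw [Equiv.swap_apply_of_ne_of_ne (Fin.succ_ne_zero i)
          (fun h => hi (Fin.succ_injective _ h))]
      have h1 := IsBallMin.stability hβ0 hβ hN hlam hne (hw _) (hw _)
      have h2 := stability_pointwise h1
      simp only [hF, hG, dualLoss]
      convert h2 using 3
      simp only [Function.comp_apply, hσ, Equiv.swap_apply_left, inner_sub_left]
      ring
    have hFc := hperm.integral_comp hemb F
    have hGc := hperm.integral_comp hemb (G j)
    have hGci : Integrable (fun Z => G j (Z ∘ σ)) ν := hperm.integrable_comp_of_integrable (hGi j)
    have hFci : Integrable (fun Z => F (Z ∘ σ)) ν := hperm.integrable_comp_of_integrable hFi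
    rw [← hFc]
    calc ∫ Z, F (Z ∘ σ) ∂ν
        ≤ ∫ Z, 201 / 199 * (200 / 199 * G j Z + 1 / 199 * G j (Z ∘ σ)) ∂ν :=
          integral_mono hFci
            ((((hGi j).const_mul _).add (hGci.const_mul _)).const_mul _) hpt
      _ = (201 / 199) ^ 2 * ∫ Z, G j Z ∂ν := by
          rw [integral_const_mul, integral_add ((hGi j).const_mul _) (hGci.const_mul _),
            integral_const_mul, integral_const_mul, hGc]
          ring
  have hGπ : ∀ j, ∫ Z, G j Z ∂ν = ∫ Z, dualLoss φ (w Z) (Z j) ∂π := by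
    intro j
    have ht := measurePreserving_tail μ N
    have hm : Measurable fun Z : Fin N → X × ℝ => dualLoss φ (w Z) (Z j) :=
      hmeas.comp (measurable_id.prodMk (measurable_pi_apply j))
    rw [hπ, ← ht.map_eq, integral_map ht.measurable.aemeasurable hm.aestronglyMeasurable]
  have hgi : ∀ j, Integrable (fun Z => dualLoss φ (w Z) (Z j)) π := fun j => by
    refine Integrable.of_bound
      (hmeas.comp (measurable_id.prodMk (measurable_pi_apply j))).aestronglyMeasurable K ?_
    filter_upwards [heval _ j] with Z hZ
    rw [Real.norm_of_nonneg (dualLoss_nonneg _ _)]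
    exact dualLoss_le hβ (hw _).1 hZ
  have hvint := integrable_dualLoss (φ := φ) hβ hM hv
  have hvi : ∀ j, Integrable (fun Z : Fin N → X × ℝ => dualLoss φ v (Z j)) π := fun j =>
    (measurePreserving_eval (fun _ : Fin N => μ) j).integrable_comp_of_integrable hvint
  have hve : ∀ j, ∫ Z : Fin N → X × ℝ, dualLoss φ v (Z j) ∂π = ∫ z, dualLoss φ v z ∂μ := by
    intro j
    have ht := measurePreserving_eval (fun _ : Fin N => μ) j
    rw [← ht.map_eq, integral_map ht.measurable.aemeasurable
      (measurable_dualLoss v).aestronglyMeasurable]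
  -- The competitor v does not depend on the training set, so the expectation of its empirical loss
  -- is its true loss.
  have hemp : 1 / (N : ℝ) * ∑ j, ∫ Z, dualLoss φ (w Z) (Z j) ∂π
      ≤ ∫ z, dualLoss φ v z ∂μ + lam * ‖v‖ ^ 2 := by
    have h1 : ∫ Z, 1 / (N : ℝ) * ∑ j, dualLoss φ (w Z) (Z j) ∂π
        ≤ ∫ Z : Fin N → X × ℝ, (1 / (N : ℝ) * ∑ j, dualLoss φ v (Z j) + lam * ‖v‖ ^ 2) ∂π := by
      refine integral_mono ((integrable_finsetSum _ fun j _ => hgi j).const_mul _)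
        (((integrable_finsetSum _ fun j _ => hvi j).const_mul _).add (integrable_const _))
        fun Z => ?_
      have := (hw Z).2 v hv
      simp only [featureLoss] at this
      have h0 : 0 ≤ lam * ‖w Z‖ ^ 2 := by positivity
      simp only [dualLoss]
      linarith
    rw [integral_const_mul, integral_finsetSum _ fun j _ => hgi j,
      integral_add ((integrable_finsetSum _ fun j _ => hvi j).const_mul _) (integrable_const _),
      integral_const_mul, integral_finsetSum _ fun j _ => hvi j] at h1
    simp only [hve, Finset.sum_const, Finset.card_univ, Fintype.card_fin, integral_const,
      probReal_univ, smul_eq_mul, nsmul_eq_mul, one_mul] at h1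
    rwa [← mul_assoc, one_div_mul_cancel hN'.ne', one_mul] at h1
  rw [hexp]
  calc ∫ Z, F Z ∂ν = 1 / (N : ℝ) * ∑ _j : Fin N, ∫ Z, F Z ∂ν := by
        simp only [Finset.sum_const, Finset.card_univ, Fintype.card_fin, nsmul_eq_mul]
        rw [← mul_assoc, one_div_mul_cancel hN'.ne', one_mul]
    _ ≤ 1 / (N : ℝ) * ∑ j, (201 / 199) ^ 2 * ∫ Z, dualLoss φ (w Z) (Z j) ∂π := by
        gcongr with j
        rw [← hGπ]
        exact hstab j
    _ = (201 / 199) ^ 2 * (1 / (N : ℝ) * ∑ j, ∫ Z, dualLoss φ (w Z) (Z j) ∂π) := by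
        rw [← Finset.mul_sum]
        ring
    _ ≤ _ := by gcongr

/-- Kernel ridge regression: existence of solutions, and the bound on the expected loss. -/
theorem kernelRidgeRegression_expectedLoss_le [FiniteDimensional ℝ H] {k : X → X → ℝ}
    (hk : ∀ x y, k x y = ⟪φ x, φ y⟫) (hβ0 : 0 < β) (hβ : ∀ x, k x x ≤ β) (hN : 0 < N)
    (hlam : 100 * β ≤ lam * N) (hM : ∀ᵐ z ∂μ, |z.2| ≤ M) {v : H} (hv : ‖v‖ ^ 2 ≤ Bsq) :
    (∀ Z : Fin N → X × ℝ, ∃ α, IsKRRSolution k lam Bsq Z α) ∧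
    ∀ α : (Fin N → X × ℝ) → Fin N → ℝ, (∀ Z, IsKRRSolution k lam Bsq Z (α Z)) →
      (∀ Z, Integrable (sqLoss k Z (α Z)) μ) ∧
      Integrable (fun Z => expectedLoss μ k Z (α Z)) (Measure.pi fun _ : Fin N => μ) ∧
      ∫ Z, expectedLoss μ k Z (α Z) ∂(Measure.pi fun _ : Fin N => μ)
        ≤ (201 / 199) ^ 2 * (∫ z, dualLoss φ v z ∂μ + lam * ‖v‖ ^ 2) := by
  have hN' : (0 : ℝ) < N := by exact_mod_cast hN
  have hlam0 : 0 < lam := by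
    by_contra! hneg
    nlinarith
  have hβ' : ∀ x, ‖φ x‖ ^ 2 ≤ β := fun x => by
    rw [← real_inner_self_eq_norm_sq, ← hk]
    exact hβ x
  refine ⟨exists_isKRRSolution hk ((sq_nonneg _).trans hv), fun α hα => ?_⟩
  have hw : ∀ Z, IsBallMin φ lam Bsq Z (dualVector φ Z (α Z)) :=
    fun Z => (hα Z).isBallMin hk hlam0.le
  have hloss : ∀ Z, sqLoss k Z (α Z) = dualLoss φ (dualVector φ Z (α Z)) := fun Z => by
    ext z
    rw [sqLoss, dualLoss, kernelModel_eq_inner hk]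
  simp only [expectedLoss, hloss]
  exact ⟨fun Z => integrable_dualLoss hβ' hM (hw Z).1,
    integral_dualLoss_ballMin_le hβ0 hβ' hN hlam hM hw hv⟩

end ExpectedLoss

end GLQK

namespace GLQK

open scoped ComplexOrder

/-! ### Tensor products and Pauli strings -/

section Tensor

variable {V : Type} [Fintype V]

theorem tensor_mul [DecidableEq V] (M N : V → Matrix (Fin 2) (Fin 2) ℂ) :
    tensor M * tensor N = tensor fun i => M i * N i := by
  ext x y
  simp only [tensor, Matrix.mul_apply, Matrix.of_apply, ← Finset.prod_mul_distrib]
  rw [Finset.prod_univ_sum, Fintype.piFinset_univ]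

theorem tensor_conjTranspose (M : V → Matrix (Fin 2) (Fin 2) ℂ) :
    (tensor M).conjTranspose = tensor fun i => (M i).conjTranspose := by
  ext x y
  simp [tensor, Matrix.conjTranspose_apply]

theorem tensor_one [DecidableEq V] : tensor (fun _ : V => 1) = 1 := by
  ext x y
  simp only [tensor, Matrix.of_apply, Matrix.one_apply]
  rw [Finset.prod_ite_zero]
  simp [funext_iff]

theorem tensor_smul (a : V → ℂ) (M : V → Matrix (Fin 2) (Fin 2) ℂ) :
    tensor (fun i => a i • M i) = (∏ i, a i) • tensor M := by
  ext x y
  simp [tensor, Finset.prod_mul_distrib]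

theorem sum_tensor [DecidableEq V] {R : Type} [Fintype R]
    (M : V → R → Matrix (Fin 2) (Fin 2) ℂ) :
    ∑ s : V → R, tensor (fun i => M i (s i)) = tensor fun i => ∑ r, M i r := by
  ext x y
  simp only [Matrix.sum_apply, tensor, Matrix.of_apply]
  rw [Finset.prod_univ_sum, Fintype.piFinset_univ]

theorem pauli_conjTranspose (q : Fin 4) : (pauli q).conjTranspose = pauli q := by
  fin_cases q <;> ext i j <;> fin_cases i <;> fin_cases j <;> simp [pauli]

theorem pauli_mul_self (q : Fin 4) : pauli q * pauli q = 1 := by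
  fin_cases q <;> ext i j <;> fin_cases i <;> fin_cases j <;>
    simp [pauli, Matrix.mul_apply]

theorem pauliString_isHermitian (P : V → Fin 4) : (pauliString P).IsHermitian := by
  rw [Matrix.IsHermitian, pauliString, tensor_conjTranspose]
  simp only [pauli_conjTranspose]

theorem pauliString_mul_self [DecidableEq V] (P : V → Fin 4) :
    pauliString P * pauliString P = 1 := by
  rw [pauliString, tensor_mul]
  simp only [pauli_mul_self, tensor_one]

/-- The Pauli string that agrees with `P` on `C` and is the identity elsewhere. -/
def restrictString (C : Finset V) [DecidableEq V] (P : V → Fin 4) : V → Fin 4 :=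
  fun i => if i ∈ C then P i else 0

theorem pauliString_eq_mul [DecidableEq V] (C : Finset V) (P : V → Fin 4) :
    pauliString P = pauliString (restrictString C P) * pauliString (restrictString Cᶜ P) := by
  rw [pauliString, pauliString, pauliString, tensor_mul]
  congr 1
  ext1 i
  by_cases h : i ∈ C <;> simp [restrictString, h, pauli]

/-- C*-identity: ‖O‖² = ‖O*O‖ = ‖1‖ ≤ 1. -/
theorem specNorm_le_one [DecidableEq V] {O : Op V} (h : O.IsHermitian) (h2 : O * O = 1) :
    specNorm O ≤ 1 := by
  set f := Matrix.toEuclideanCLM (n := V → Fin 2) (𝕜 := ℂ) with hf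
  have h3 : ‖f O‖ * ‖f O‖ = ‖f 1‖ := by
    rw [← CStarRing.norm_star_mul_self, ← map_star, ← map_mul, Matrix.star_eq_conjTranspose, h.eq,
      h2]
  have h4 : ‖f 1‖ ≤ 1 := by
    rw [map_one]
    exact ContinuousLinearMap.norm_id_le
  change ‖f O‖ ≤ 1
  nlinarith [norm_nonneg (f O)]

theorem actsOn_pauliString [DecidableEq V] {A : Finset V} {P : V → Fin 4}
    (h : ∀ i, i ∉ A → P i = 0) : ActsOn A (pauliString P) := by
  refine ⟨tensor fun i => pauli (P i), fun x y => ?_⟩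
  simp only [pauliString, tensor, Matrix.of_apply]
  split_ifs with hxy
  · rw [← Finset.prod_subset (Finset.subset_univ A) fun i _ hi => by
      rw [h i hi, hxy i hi, pauli, Matrix.one_apply_eq]]
    exact (Finset.prod_coe_sort A fun i => pauli (P i) (x i) (y i)).symm
  · push Not at hxy
    obtain ⟨i, hi, hne⟩ := hxy
    refine Finset.prod_eq_zero (Finset.mem_univ i) ?_
    simp [h i hi, pauli, hne]

theorem half_one_add_smul_mul_self {n : Type} [Fintype n] [DecidableEq n] {s : ℝ}
    (hs : s ^ 2 = 1) {M : Matrix n n ℂ} (hM : M * M = 1) :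
    ((1 / 2 : ℂ) • (1 + (s : ℂ) • M)) * ((1 / 2 : ℂ) • (1 + (s : ℂ) • M))
      = (1 / 2 : ℂ) • (1 + (s : ℂ) • M) := by
  have hs' : (s : ℂ) * s = 1 := by
    rw [← sq]
    exact_mod_cast hs
  have h2 : ((s : ℂ) • M) * ((s : ℂ) • M) = 1 := by
    rw [Matrix.smul_mul, Matrix.mul_smul, hM, smul_smul, hs', one_smul]
  rw [Matrix.smul_mul, Matrix.mul_smul, mul_add, add_mul, add_mul, h2, one_mul, mul_one, one_mul]
  module

theorem half_one_add_smul_isHermitian {n : Type} [DecidableEq n] (s : ℝ)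
    {M : Matrix n n ℂ} (hM : M.IsHermitian) :
    ((1 / 2 : ℂ) • (1 + (s : ℂ) • M)).IsHermitian := by
  rw [Matrix.IsHermitian, Matrix.conjTranspose_smul, Matrix.conjTranspose_add,
    Matrix.conjTranspose_smul, hM.eq]
  simp

/-- For a projection, cyclicity turns the trace into that of the positive matrix OρO†. -/
theorem trace_mul_state_re_nonneg [DecidableEq V] {O : Op V} (h : O.IsHermitian)
    (h2 : O * O = O) (ρ : QState V) : 0 ≤ (Matrix.trace (O * ρ.mat)).re := by
  have h3 : Matrix.trace (O * ρ.mat) = Matrix.trace (O * ρ.mat * O.conjTranspose) := by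
    rw [h.eq, Matrix.trace_mul_comm (O * ρ.mat) O, ← mul_assoc, h2]
  rw [h3]
  exact (Complex.le_def.1 (ρ.posSemidef.mul_mul_conjTranspose_same O).trace_nonneg).1

/-- A Pauli string squares to the identity, so (1 ± P)/2 are projections and have nonnegative
expectation values. -/
theorem abs_pauliExp_le_one [DecidableEq V] (P : V → Fin 4) (ρ : QState V) :
    |pauliExp P ρ| ≤ 1 := by
  have key : ∀ s : ℝ, s ^ 2 = 1 → 0 ≤ 1 + s * pauliExp P ρ := by
    intro s hs
    have h3 := trace_mul_state_re_nonneg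
      (half_one_add_smul_isHermitian s (pauliString_isHermitian P))
      (half_one_add_smul_mul_self hs (pauliString_mul_self P)) ρ
    rw [Matrix.smul_mul, add_mul, one_mul, Matrix.smul_mul, Matrix.trace_smul,
      Matrix.trace_add, Matrix.trace_smul, ρ.trace_eq_one] at h3
    have h4 : ((1 / 2 : ℂ) • (1 + (s : ℂ) • Matrix.trace (pauliString P * ρ.mat))).re
        = 1 / 2 * (1 + s * pauliExp P ρ) := by
      rw [show (1 / 2 : ℂ) = ((1 / 2 : ℝ) : ℂ) by push_cast; rfl, smul_eq_mul,
        Complex.re_ofReal_mul, Complex.add_re, Complex.one_re, smul_eq_mul, Complex.re_ofReal_mul,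
        pauliExp]
    rw [h4] at h3
    linarith
  rw [abs_le]
  constructor
  · linarith [key 1 (by norm_num)]
  · linarith [key (-1) (by norm_num)]

theorem expect_pauliString [DecidableEq V] (P : V → Fin 4) (ρ : QState V) :
    expect (pauliString P) ρ = (pauliExp P ρ : ℂ) := by
  have h : star (expect (pauliString P) ρ) = expect (pauliString P) ρ := by
    rw [expect, ← Matrix.trace_conjTranspose, Matrix.conjTranspose_mul,
      (pauliString_isHermitian P).eq, ρ.posSemidef.1.eq, Matrix.trace_mul_comm]
  exact (Complex.conj_eq_iff_re.1 h).symm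

theorem pauliExp_zero [DecidableEq V] (ρ : QState V) : pauliExp (fun _ => 0) ρ = 1 := by
  have : pauliString (fun _ : V => 0) = 1 := tensor_one
  rw [pauliExp, this, one_mul, ρ.trace_eq_one, Complex.one_re]

end Tensor

/-! ### Random Pauli measurements -/

section Shots

/-- The value `tr(q σ)` of the single-qubit Pauli operator `q` on the local shadow `σ` of `r`. -/
noncomputable def localEst (q : Fin 4) (r : Fin 3 × Bool) : ℝ :=
  if q = 0 then 1 else if q = r.1.succ then 3 * sgn r.2 else 0

theorem abs_sgn (o : Bool) : |sgn o| = 1 := by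
  cases o <;> simp [sgn]

theorem localEst_zero (r : Fin 3 × Bool) : localEst 0 r = 1 := if_pos rfl

theorem localEst_succ (w : Fin 3) (r : Fin 3 × Bool) :
    localEst w.succ r = if w = r.1 then 3 * sgn r.2 else 0 := by
  simp [localEst, Fin.succ_ne_zero]

theorem abs_localEst_le (q : Fin 4) (r : Fin 3 × Bool) :
    |localEst q r| ≤ if q = 0 then 1 else 3 := by
  unfold localEst
  split_ifs <;> simp [abs_mul, abs_sgn]

/-- Unbiasedness on one qubit: the factor 3 in the estimate compensates for the probability 1/3 of
measuring in the basis q. -/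
theorem sum_localEst_smul_outcomeProj (q : Fin 4) :
    ∑ r, (localEst q r : ℂ) • (1 / 3 : ℂ) • outcomeProj r = pauli q := by
  have e0 : basisOp 0 = !![0, 1; 1, 0] := rfl
  have e1 : basisOp 1 = !![0, -Complex.I; Complex.I, 0] := rfl
  have e2 : basisOp 2 = !![1, 0; 0, -1] := rfl
  rw [Fintype.sum_prod_type]
  simp only [Fin.sum_univ_three, Fintype.sum_bool]
  refine Fin.cases ?_ (fun w => ?_) q
  · ext i j
    fin_cases i <;> fin_cases j <;>
      simp [localEst_zero, outcomeProj, e0, e1, e2, pauli, sgn] <;> ring_nf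
  · rw [← basisOp]
    simp only [localEst_succ]
    ext i j
    fin_cases w <;> fin_cases i <;> fin_cases j <;>
      simp [outcomeProj, e0, e1, e2, sgn] <;> ring_nf

/-- The local shadow is ½ ∑ localEst q r • q, and the Pauli matrices are orthogonal with tr(q²) = 2.
This diagonalizes the kernel in Pauli strings. -/
theorem trace_localShadow_mul (r r' : Fin 3 × Bool) :
    (Matrix.trace (localShadow r * localShadow r')).re
      = 1 / 2 * ∑ q, localEst q r * localEst q r' := by
  have e0 : basisOp 0 = !![0, 1; 1, 0] := rfl
  have e1 : basisOp 1 = !![0, -Complex.I; Complex.I, 0] := rfl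
  have e2 : basisOp 2 = !![1, 0; 0, -1] := rfl
  obtain ⟨w, o⟩ := r
  obtain ⟨w', o'⟩ := r'
  rw [Fin.sum_univ_succ, Fin.sum_univ_three]
  simp only [localEst_zero, localEst_succ]
  fin_cases w <;> fin_cases w' <;> cases o <;> cases o' <;>
    simp [localShadow, e0, e1, e2, sgn, Matrix.trace, Matrix.mul_apply, Fin.sum_univ_two] <;>
    norm_num

theorem outcomeProj_conjTranspose (r : Fin 3 × Bool) :
    (outcomeProj r).conjTranspose = outcomeProj r :=
  half_one_add_smul_isHermitian _ (pauli_conjTranspose _)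

theorem outcomeProj_mul_self (r : Fin 3 × Bool) :
    outcomeProj r * outcomeProj r = outcomeProj r :=
  half_one_add_smul_mul_self (by rw [← sq_abs, abs_sgn, one_pow]) (pauli_mul_self _)

variable {V : Type} [Fintype V] [DecidableEq V]

theorem shotProb_nonneg (ρ : QState V) (s : Shot V) : 0 ≤ shotProb ρ s := by
  refine mul_nonneg (by positivity) (trace_mul_state_re_nonneg ?_ ?_ ρ)
  · rw [Matrix.IsHermitian, tensor_conjTranspose]
    simp only [outcomeProj_conjTranspose]
  · rw [tensor_mul]
    simp only [outcomeProj_mul_self]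

/-- The estimate of `tr(P ρ)` from a single shot. -/
noncomputable def shotEst (P : V → Fin 4) (s : Shot V) : ℝ := ∏ i, localEst (P i) (s i)

omit [DecidableEq V] in
theorem abs_shotEst_le (P : V → Fin 4) (s : Shot V) : |shotEst P s| ≤ 3 ^ pauliWeight P := by
  rw [shotEst, Finset.abs_prod]
  refine (Finset.prod_le_prod (fun i _ => abs_nonneg _) fun i _ => abs_localEst_le _ _).trans ?_
  rw [Finset.prod_ite]
  simp [pauliWeight]

/-- The single-shot estimates are unbiased. -/
theorem sum_shotProb_mul_shotEst (P : V → Fin 4) (ρ : QState V) :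
    ∑ s, shotProb ρ s * shotEst P s = pauliExp P ρ := by
  have h1 : ∀ s : Shot V, shotProb ρ s * shotEst P s = (Matrix.trace
      (tensor (fun i => (localEst (P i) (s i) : ℂ) • (1 / 3 : ℂ) • outcomeProj (s i))
        * ρ.mat)).re := by
    intro s
    rw [tensor_smul, tensor_smul, smul_smul, Matrix.smul_mul, Matrix.trace_smul, smul_eq_mul]
    have : (∏ i, (localEst (P i) (s i) : ℂ)) * ∏ _i : V, (1 / 3 : ℂ)
        = ((shotEst P s * (1 / 3) ^ Fintype.card V : ℝ) : ℂ) := by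
      simp [shotEst]
    rw [this, Complex.re_ofReal_mul, shotProb]
    ring
  simp only [h1]
  rw [← Complex.re_sum, ← Matrix.trace_sum, ← Finset.sum_mul,
    sum_tensor (fun i r => (localEst (P i) r : ℂ) • (1 / 3 : ℂ) • outcomeProj r)]
  simp only [sum_localEst_smul_outcomeProj]
  rfl

theorem sum_shotProb (ρ : QState V) : ∑ s, shotProb ρ s = 1 := by
  have h := sum_shotProb_mul_shotEst (fun _ => 0) ρ
  rw [pauliExp_zero] at h
  rw [← h]
  simp [shotEst, localEst]

end Shots

end GLQK

namespace GLQK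

/-! ### Clusters of sites on the periodic lattice -/

section Lattice

variable {D : ℕ} {L : Fin D → ℕ}

/-- The sites of `C` have lifts to `ℤ^D` whose coordinates differ by at most `r`. -/
def HasSpread (C : Finset (Site L)) (r : ℝ) : Prop :=
  ∃ x : Site L → Fin D → ℤ, (∀ b ∈ C, ∀ μ, (x b μ : ZMod (L μ)) = b μ) ∧
    ∀ μ, ∀ b ∈ C, ∀ b' ∈ C, ((x b μ - x b' μ : ℤ) : ℝ) ≤ r

theorem hasSpread_singleton (b : Site L) : HasSpread {b} 0 := by
  refine ⟨fun b μ => (b μ).valMinAbs, fun b _ μ => ZMod.coe_valMinAbs _, fun μ b hb b' hb' => ?_⟩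
  rw [Finset.mem_singleton] at hb hb'
  simp [hb, hb']

/-- The lift of the new site is placed next to the lift of c by a shortest displacement, each of
whose coordinates is at most the lattice distance. -/
theorem HasSpread.insert {C : Finset (Site L)} {r δ : ℝ} (h : HasSpread C r) {b c : Site L}
    (hc : c ∈ C) (hb : b ∉ C) (hd : (siteDist c b : ℝ) < δ) : HasSpread (insert b C) (r + δ) := by
  classical
  obtain ⟨x, hx, hr⟩ := h
  have hv : ∀ μ, |(((c μ - b μ).valMinAbs : ℤ) : ℝ)| ≤ δ := fun μ => by
    refine le_trans ?_ hd.le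
    rw [← Int.cast_abs, Int.abs_eq_natAbs, Int.cast_natCast, Nat.cast_le]
    exact Finset.single_le_sum (f := fun μ => (c μ - b μ).valMinAbs.natAbs)
      (fun _ _ => Nat.zero_le _) (Finset.mem_univ μ)
  have hne : ∀ b' ∈ C, b' ≠ b := fun b' hb' h => hb (h ▸ hb')
  refine ⟨Function.update x b fun μ => x c μ - (c μ - b μ).valMinAbs, ?_, ?_⟩
  · intro b' hb' μ
    rcases Finset.mem_insert.1 hb' with rfl | hb'
    · simp [hx c hc]
    · rw [Function.update_of_ne (hne b' hb')]
      exact hx b' hb' μ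
  · intro μ b₁ h₁ b₂ h₂
    have h3 := abs_le.1 (hv μ)
    have hcc := hr μ c hc c hc
    simp only [sub_self, Int.cast_zero] at hcc
    rcases Finset.mem_insert.1 h₁ with e₁ | m₁ <;> rcases Finset.mem_insert.1 h₂ with e₂ | m₂
    · rw [e₁, e₂]
      simp only [sub_self, Int.cast_zero]
      linarith [(Nat.cast_nonneg (siteDist c b) : (0 : ℝ) ≤ _)]
    · rw [e₁, Function.update_self, Function.update_of_ne (hne b₂ m₂)]
      have := hr μ c hc b₂ m₂
      push_cast at this ⊢
      linarith
    · rw [e₂, Function.update_self, Function.update_of_ne (hne b₁ m₁)]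
      have := hr μ b₁ m₁ c hc
      push_cast at this ⊢
      linarith
    · rw [Function.update_of_ne (hne b₁ m₁), Function.update_of_ne (hne b₂ m₂)]
      have := hr μ b₁ m₁ b₂ m₂
      linarith [(Nat.cast_nonneg (siteDist c b) : (0 : ℝ) ≤ _)]

/-- Every nonempty set of sites has a cluster of small extent that is at distance at least `δ`
from the other sites of the set. -/
theorem exists_cluster (S : Finset (Site L)) (hS : S.Nonempty) (δ : ℝ) :
    ∃ C ⊆ S, C.Nonempty ∧ HasSpread C (((C.card : ℝ) - 1) * δ) ∧
      ∀ c ∈ C, ∀ b ∈ S \ C, δ ≤ siteDist c b := by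
  classical
  set F := S.powerset.filter fun C => C.Nonempty ∧ HasSpread C (((C.card : ℝ) - 1) * δ)
  obtain ⟨s₀, hs₀⟩ := hS
  have hF : F.Nonempty := ⟨{s₀}, by
    refine Finset.mem_filter.2 ⟨by simpa using hs₀, by simp, ?_⟩
    simpa using hasSpread_singleton s₀⟩
  -- A largest set with spread at most (|C| - 1)δ works: a site of S outside C at distance less than
  -- δ from C could be added to it.
  obtain ⟨C, hC, hmax⟩ := F.exists_max_image Finset.card hF
  obtain ⟨hCS, hne, hsp⟩ := Finset.mem_filter.1 hC
  rw [Finset.mem_powerset] at hCS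
  refine ⟨C, hCS, hne, hsp, fun c hc b hb => ?_⟩
  by_contra! hlt
  rw [Finset.mem_sdiff] at hb
  have hins := hsp.insert hc hb.2 hlt
  have hcard : (insert b C).card = C.card + 1 := Finset.card_insert_of_notMem hb.2
  have hmem : insert b C ∈ F := by
    refine Finset.mem_filter.2
      ⟨Finset.mem_powerset.2 (Finset.insert_subset hb.1 hCS), Finset.insert_nonempty _ _, ?_⟩
    rw [hcard]
    convert hins using 1
    push_cast
    ring
  have := hmax _ hmem
  omega

variable [∀ μ, NeZero (L μ)]

/-- The corner takes the smallest lifted coordinate in each direction. Reducing an offset modulo the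
side length can only decrease it, so wrapping around the lattice does no harm; the strict inequality
matches the half-open box. -/
theorem HasSpread.subset_box {C : Finset (Site L)} {r ζ : ℝ} (h : HasSpread C r) (hr : r < ζ)
    (hC : C.Nonempty) : ∃ a, C ⊆ box ζ a := by
  obtain ⟨x, hx, hd⟩ := h
  have hmin : ∀ μ, ∃ b ∈ C, ∀ b' ∈ C, x b μ ≤ x b' μ := fun μ =>
    C.exists_min_image (fun b => x b μ) hC
  choose lo hlo hle using hmin
  refine ⟨fun μ => lo μ μ, fun b hb => ?_⟩
  simp only [box, Finset.mem_filter, Finset.mem_univ, true_and]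
  intro μ
  obtain ⟨n, hn⟩ := Int.eq_ofNat_of_zero_le (sub_nonneg.2 (hle μ b hb))
  have h1 : b μ - lo μ μ = ((n : ℕ) : ZMod (L μ)) := by
    rw [← hx b hb μ, ← hx (lo μ) (hlo μ) μ, ← Int.cast_sub, hn, Int.cast_natCast]
  have h2 := hd μ b hb (lo μ) (hlo μ)
  rw [hn, Int.cast_natCast] at h2
  rw [h1, ZMod.val_natCast]
  refine lt_of_le_of_lt ?_ hr
  refine le_trans ?_ h2
  exact_mod_cast Nat.mod_le _ _

omit [∀ μ, NeZero (L μ)] in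
theorem le_setDist {A B : Finset (Site L)} (hA : A.Nonempty) (hB : B.Nonempty) {δ : ℝ}
    (h : ∀ a ∈ A, ∀ b ∈ B, δ ≤ siteDist a b) : δ ≤ setDist A B := by
  obtain ⟨a, ha⟩ := hA
  obtain ⟨b, hb⟩ := hB
  have hne : {d | ∃ a ∈ A, ∃ b ∈ B, d = siteDist a b}.Nonempty := ⟨_, a, ha, b, hb, rfl⟩
  obtain ⟨a', ha', b', hb', hd⟩ := Nat.sInf_mem hne
  rw [setDist, hd]
  exact h a' ha' b' hb'

theorem card_box_le (ζ : ℝ) (a : Site L) : (box ζ a).card ≤ ⌈ζ⌉₊ ^ D := by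
  have h : (box ζ a).card ≤ (Fintype.piFinset fun _ : Fin D => Finset.range ⌈ζ⌉₊).card := by
    refine Finset.card_le_card_of_injOn (fun b μ => (b μ - a μ).val) ?_ ?_
    · intro b hb
      simp only [box, Finset.coe_filter, Finset.mem_univ, true_and, Set.mem_ofPred_eq] at hb
      simp only [Finset.mem_coe, Fintype.mem_piFinset, Finset.mem_range]
      exact fun μ => Nat.lt_ceil.2 (hb μ)
    · intro b _ b' _ h
      ext1 μ
      have := ZMod.val_injective _ (congrFun h μ)
      simpa using this
  simpa using h

theorem self_mem_box {ζ : ℝ} (hζ : 0 < ζ) (a : Site L) : a ∈ box ζ a := by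
  simp [box, hζ]

theorem add_mem_box {ζ : ℝ} {a i : Site L} (h : i ∈ box ζ a) (v : Site L) :
    i + v ∈ box ζ (a + v) := by
  simpa [box] using h

end Lattice

/-! ### Translations of Pauli strings -/

section Translation

variable {D : ℕ} {L : Fin D → ℕ} [∀ μ, NeZero (L μ)]

/-- Unit translations generate all translations: v is the sum of its coordinates' representatives
times the unit vectors. -/
theorem TranslationInvariant.mat_shift {ρ : QState (Site L)} (h : TranslationInvariant ρ)
    (v : Site L) (x y : Site L → Fin 2) :
    ρ.mat (fun a => x (a + v)) (fun a => y (a + v)) = ρ.mat x y := by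
  have h1 : ∀ (μ : Fin D) (x y : Site L → Fin 2),
      ρ.mat (fun a => x (a + Pi.single μ 1)) (fun a => y (a + Pi.single μ 1)) = ρ.mat x y := by
    intro μ x y
    have hx : ∀ x z : Site L → Fin 2,
        (x = fun a => z (a - Pi.single μ 1)) ↔ z = fun a => x (a + Pi.single μ 1) := by
      intro x z
      constructor
      · rintro rfl
        simp
      · rintro rfl
        simp
    conv_rhs => rw [← h μ]
    simp [Matrix.mul_apply, translationOp, Matrix.conjTranspose_apply, hx]
  have h2 : ∀ (μ : Fin D) (n : ℕ) (x y : Site L → Fin 2),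
      ρ.mat (fun a => x (a + n • Pi.single μ 1)) (fun a => y (a + n • Pi.single μ 1))
        = ρ.mat x y := by
    intro μ n
    induction n with
    | zero => simp
    | succ n ih =>
      intro x y
      have := h1 μ (fun a => x (a + n • Pi.single μ 1)) (fun a => y (a + n • Pi.single μ 1))
      rw [ih] at this
      simpa only [succ_nsmul, add_assoc, add_comm, add_left_comm] using this
  have h3 : ∀ (s : Finset (Fin D)) (x y : Site L → Fin 2),
      ρ.mat (fun a => x (a + ∑ μ ∈ s, (v μ).val • Pi.single μ 1))
        (fun a => y (a + ∑ μ ∈ s, (v μ).val • Pi.single μ 1)) = ρ.mat x y := by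
    intro s
    induction s using Finset.induction_on with
    | empty => simp
    | insert μ s hμ ih =>
      intro x y
      have := h2 μ (v μ).val (fun a => x (a + ∑ μ ∈ s, (v μ).val • Pi.single μ 1))
        (fun a => y (a + ∑ μ ∈ s, (v μ).val • Pi.single μ 1))
      rw [ih] at this
      rw [Finset.sum_insert hμ]
      simpa only [add_assoc] using this
  have hv : ∑ μ, (v μ).val • (Pi.single μ 1 : Site L) = v := by
    ext1 ν
    rw [Finset.sum_apply, Finset.sum_eq_single ν]
    · simp
    · intro μ _ hμ
      simp [Pi.single_eq_of_ne (Ne.symm hμ)]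
    · simp
  have := h3 Finset.univ x y
  rwa [hv] at this

/-- The translate of the Pauli string `P` by `v`. -/
def shiftString (v : Site L) (P : Site L → Fin 4) : Site L → Fin 4 := fun i => P (i - v)

theorem pauliExp_shiftString {ρ : QState (Site L)} (h : TranslationInvariant ρ) (v : Site L)
    (P : Site L → Fin 4) : pauliExp (shiftString v P) ρ = pauliExp P ρ := by
  set e : (Site L → Fin 2) ≃ (Site L → Fin 2) := (Equiv.addRight v).arrowCongr (Equiv.refl _)
  have he : ∀ x i, e x i = x (i - v) := fun x i => by
    simp [e, Equiv.arrowCongr, sub_eq_add_neg]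
  have h1 : ∀ x y, pauliString (shiftString v P) (e x) (e y) = pauliString P x y := by
    intro x y
    simp only [pauliString, tensor, Matrix.of_apply, shiftString, he]
    exact Equiv.prod_comp (Equiv.subRight v) fun i => pauli (P i) (x i) (y i)
  have h2 : ∀ x y, ρ.mat (e x) (e y) = ρ.mat x y := by
    intro x y
    rw [← h.mat_shift v (e x) (e y)]
    congr 1 <;> ext1 a <;> simp [he]
  simp only [pauliExp, Matrix.trace, Matrix.diag, Matrix.mul_apply]
  rw [← e.sum_comp]
  congr 1
  refine Finset.sum_congr rfl fun x _ => ?_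
  rw [← e.sum_comp]
  exact Finset.sum_congr rfl fun y _ => by rw [h1, h2]

theorem pauliWeight_shiftString (v : Site L) (P : Site L → Fin 4) :
    pauliWeight (shiftString v P) = pauliWeight P := by
  refine Finset.card_bij (fun i _ => i - v) ?_ ?_ ?_
  · intro i hi
    rw [Finset.mem_filter] at hi ⊢
    exact ⟨Finset.mem_univ _, hi.2⟩
  · intro i _ j _ hij
    simpa using hij
  · intro i hi
    rw [Finset.mem_filter] at hi
    exact ⟨i + v, Finset.mem_filter.2 ⟨Finset.mem_univ _, by simpa [shiftString] using hi.2⟩,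
      by simp⟩

end Translation

/-! ### Cluster decomposition of Pauli expectation values -/

section ClusterDecomposition

variable {D : ℕ} {L : Fin D → ℕ} [∀ μ, NeZero (L μ)]

/-- Clustering is applied to C and to the rest B of the support. It is assumed only for nonempty
regions; if one of them is empty, the corresponding factor is 1 and the factorization is exact. -/
theorem HasECP.abs_pauliExp_sub_le {ξ : ℝ} (hξ : 0 < ξ) {ρ : QState (Site L)} (h : HasECP ξ ρ)
    (P : Site L → Fin 4) (C : Finset (Site L)) {δ : ℝ}
    (hd : ∀ c ∈ C, ∀ b, b ∉ C → P b ≠ 0 → δ ≤ siteDist c b) :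
    |pauliExp P ρ - pauliExp (restrictString C P) ρ * pauliExp (restrictString Cᶜ P) ρ|
      ≤ Real.exp (-δ / ξ) := by
  set B := Finset.univ.filter fun b => b ∉ C ∧ P b ≠ 0 with hB
  have hmul : expect (pauliString (restrictString C P) * pauliString (restrictString Cᶜ P)) ρ
      = (pauliExp P ρ : ℂ) := by
    rw [← pauliString_eq_mul, expect_pauliString]
  have htriv : ∀ {a b : ℝ}, a = b → |a - b| ≤ Real.exp (-δ / ξ) := fun {a b} hab => by
    rw [hab, sub_self, abs_zero]
    positivity
  rcases B.eq_empty_or_nonempty with hBe | hBn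
  · have h1 : restrictString Cᶜ P = fun _ => 0 := by
      ext1 i
      by_cases hi : i ∈ C
      · simp [restrictString, hi]
      · have : i ∉ B := by simp [hBe]
        simp only [hB, Finset.mem_filter, Finset.mem_univ, true_and, not_and, not_not] at this
        simp [restrictString, this hi]
    have h2 : restrictString C P = P := by
      ext1 i
      have := congrFun h1 i
      by_cases hi : i ∈ C
      · simp [restrictString, hi]
      · simp only [restrictString, Finset.mem_compl, hi, not_false_eq_true, if_true] at this
        simp [restrictString, hi, this]
    rw [h1, h2, pauliExp_zero, mul_one]
    exact htriv rfl
  rcases C.eq_empty_or_nonempty with rfl | hCn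
  · have h1 : restrictString ∅ P = fun _ => 0 := by
      ext1 i
      simp [restrictString]
    have h2 : restrictString ∅ᶜ P = P := by
      ext1 i
      simp [restrictString]
    rw [h1, h2, pauliExp_zero, one_mul]
    exact htriv rfl
  have hdist : δ ≤ setDist C B := le_setDist hCn hBn fun c hc b hb => by
    simp only [hB, Finset.mem_filter, Finset.mem_univ, true_and] at hb
    exact hd c hc b hb.1 hb.2
  have h1 := h C B hCn hBn _ _ (pauliString_isHermitian _) (pauliString_isHermitian _)
    (actsOn_pauliString (P := restrictString C P) fun i hi => by simp [restrictString, hi])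
    (actsOn_pauliString (P := restrictString Cᶜ P) fun i hi => by
      by_cases hC : i ∈ C
      · simp [restrictString, hC]
      · simp only [hB, Finset.mem_filter, Finset.mem_univ, true_and, not_and, not_not] at hi
        simp [restrictString, hi hC])
  rw [hmul, expect_pauliString, expect_pauliString, ← Complex.ofReal_mul, ← Complex.ofReal_sub,
    Complex.norm_real, Real.norm_eq_abs] at h1
  refine h1.trans ?_
  have hs1 := specNorm_le_one (pauliString_isHermitian (restrictString C P))
    (pauliString_mul_self _)
  have hs2 := specNorm_le_one (pauliString_isHermitian (restrictString Cᶜ P))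
    (pauliString_mul_self _)
  have hs : specNorm (pauliString (restrictString C P))
      * specNorm (pauliString (restrictString Cᶜ P)) ≤ 1 :=
    mul_le_one₀ hs1 (norm_nonneg _) hs2
  calc _ ≤ 1 * Real.exp (-(setDist C B : ℝ) / ξ) := by gcongr
    _ ≤ Real.exp (-δ / ξ) := by
      rw [one_mul]
      gcongr

/-- Up to a small error, the expectation value of a Pauli string is a product of expectation
values of Pauli strings that are supported in boxes. -/
theorem exists_list_abs_pauliExp_sub_le {ξ : ℝ} (hξ : 0 < ξ) {m : ℕ} {δ : ℝ} (hδ : 0 < δ)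
    (w : ℕ) (P : Site L → Fin 4) (hw : pauliWeight P = w) (hm : w ≤ m) :
    ∃ l : List (Site L → Fin 4), l.length ≤ w ∧ (l.map pauliWeight).sum = w ∧
      (∀ Q ∈ l, ∃ a, ∀ i, Q i ≠ 0 → i ∈ box (m * δ) a) ∧
      ∀ ρ, HasECP ξ ρ →
        |pauliExp P ρ - (l.map fun Q => pauliExp Q ρ).prod| ≤ w * Real.exp (-δ / ξ) := by
  induction w using Nat.strong_induction_on generalizing P with
  | _ w ih =>
  rcases Nat.eq_zero_or_pos w with rfl | hpos
  · have hP : P = fun _ => 0 := by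
      ext1 i
      have : i ∉ Finset.univ.filter fun i => P i ≠ 0 := by
        rw [Finset.card_eq_zero.1 hw]
        simp
      simpa using this
    exact ⟨[], by simp, by simp, by simp, fun ρ _ => by simp [hP, pauliExp_zero]⟩
  set S := Finset.univ.filter fun i => P i ≠ 0 with hS
  have hScard : S.card = w := hw
  obtain ⟨C, hCS, hCn, hsp, hfar⟩ := exists_cluster S (Finset.card_pos.1 (hScard ▸ hpos)) δ
  have hCpos : 0 < C.card := hCn.card_pos
  have hCle : C.card ≤ w := hScard ▸ Finset.card_le_card hCS
  have hmem : ∀ i ∈ C, P i ≠ 0 := fun i hi => (Finset.mem_filter.1 (hCS hi)).2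
  have hwQ : pauliWeight (restrictString C P) = C.card := by
    unfold pauliWeight
    congr 1
    ext i
    by_cases hi : i ∈ C <;> simp [restrictString, hi, hmem]
  have hwR : pauliWeight (restrictString Cᶜ P) = w - C.card := by
    rw [← hScard, ← Finset.card_sdiff_of_subset hCS]
    unfold pauliWeight
    congr 1
    ext i
    by_cases hi : i ∈ C <;> simp [restrictString, hi, hS]
  obtain ⟨l, hl1, hl2, hl3, hl4⟩ := ih (w - C.card) (by omega) _ hwR (by omega)
  -- The -1 in the spread of a cluster gives the strict inequality that the half-open box needs.
  have hlt : ((C.card : ℝ) - 1) * δ < m * δ := by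
    have : (C.card : ℝ) ≤ m := by exact_mod_cast hCle.trans hm
    nlinarith
  obtain ⟨a, ha⟩ := hsp.subset_box hlt hCn
  refine ⟨restrictString C P :: l, ?_, ?_, ?_, ?_⟩
  · rw [List.length_cons]
    omega
  · rw [List.map_cons, List.sum_cons, hl2, hwQ]
    omega
  · intro Q hQ
    rcases List.mem_cons.1 hQ with rfl | hQ
    · refine ⟨a, fun i hi => ha ?_⟩
      by_contra hiC
      exact hi (by simp [restrictString, hiC])
    · exact hl3 Q hQ
  · intro ρ hρ
    rw [List.map_cons, List.prod_cons]
    have h1 := hρ.abs_pauliExp_sub_le hξ P C (δ := δ) fun c hc b hb hPb =>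
      hfar c hc b (Finset.mem_sdiff.2 ⟨Finset.mem_filter.2 ⟨Finset.mem_univ _, hPb⟩, hb⟩)
    have h2 := hl4 ρ hρ
    have h3 := abs_pauliExp_le_one (restrictString C P) ρ
    set q := pauliExp (restrictString C P) ρ
    set r := pauliExp (restrictString Cᶜ P) ρ
    set t := (l.map fun Q => pauliExp Q ρ).prod
    have h4 : |q * (r - t)| ≤ ((w - C.card : ℕ) : ℝ) * Real.exp (-δ / ξ) := by
      rw [abs_mul]
      exact (mul_le_of_le_one_left (abs_nonneg _) h3).trans h2
    -- Each cluster removes at least one site, so a string of weight w costs at most w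
    -- factorizations.
    have h5 : ((w - C.card : ℕ) : ℝ) + 1 ≤ w := by
      exact_mod_cast (by omega : w - C.card + 1 ≤ w)
    calc |pauliExp P ρ - q * t| = |(pauliExp P ρ - q * r) + q * (r - t)| := by ring_nf
      _ ≤ Real.exp (-δ / ξ) + ((w - C.card : ℕ) : ℝ) * Real.exp (-δ / ξ) :=
        (abs_add_le _ _).trans (add_le_add h1 h4)
      _ = (((w - C.card : ℕ) : ℝ) + 1) * Real.exp (-δ / ξ) := by ring
      _ ≤ w * Real.exp (-δ / ξ) := by gcongr

theorem abs_prod_sub_prod_le {κ : Type} (s : Finset κ) {a b : κ → ℝ} (ha : ∀ i, |a i| ≤ 1)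
    (hb : ∀ i, |b i| ≤ 1) : |∏ i ∈ s, a i - ∏ i ∈ s, b i| ≤ ∑ i ∈ s, |a i - b i| := by
  classical
  induction s using Finset.induction_on with
  | empty => simp
  | insert i s hi ih =>
    rw [Finset.prod_insert hi, Finset.prod_insert hi, Finset.sum_insert hi]
    have h1 : |∏ i ∈ s, a i| ≤ 1 := by
      rw [Finset.abs_prod]
      exact Finset.prod_le_one (fun _ _ => abs_nonneg _) fun i _ => ha i
    calc |a i * ∏ i ∈ s, a i - b i * ∏ i ∈ s, b i|
        = |(a i - b i) * ∏ i ∈ s, a i + b i * (∏ i ∈ s, a i - ∏ i ∈ s, b i)| := by ring_nf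
      _ ≤ |a i - b i| * |∏ i ∈ s, a i| + |b i| * |∏ i ∈ s, a i - ∏ i ∈ s, b i| := by
        rw [← abs_mul, ← abs_mul]
        exact abs_add_le _ _
      _ ≤ |a i - b i| * 1 + 1 * ∑ i ∈ s, |a i - b i| := by
        gcongr
        exact hb i
      _ = _ := by ring

theorem abs_list_prod_pauliExp_le_one (l : List (Site L → Fin 4)) (ρ : QState (Site L)) :
    |(l.map fun Q => pauliExp Q ρ).prod| ≤ 1 := by
  induction l with
  | nil => simp
  | cons Q l ih =>
    rw [List.map_cons, List.prod_cons, abs_mul]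
    exact mul_le_one₀ (abs_pauliExp_le_one Q ρ) (abs_nonneg _) ih

/-- For translation-invariant states with exponential clustering, a product of Pauli expectation
values is, up to a small error, a product of expectation values of strings supported in any given
box. -/
theorem exists_list_supported_in_box {ξ : ℝ} (hξ : 0 < ξ) {m p : ℕ} {δ : ℝ} (hδ : 0 < δ)
    (P : Fin p → Site L → Fin 4) (hP : ∀ j, pauliWeight (P j) ≤ m) (a : Site L) :
    ∃ l : List (Site L → Fin 4), l.length ≤ m * p ∧ (l.map pauliWeight).sum ≤ m * p ∧
      (∀ Q ∈ l, pauliWeight Q ≤ m ∧ ∀ i, Q i ≠ 0 → i ∈ box (m * δ) a) ∧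
      ∀ ρ, TranslationInvariant ρ → HasECP ξ ρ →
        |∏ j, pauliExp (P j) ρ - (l.map fun Q => pauliExp Q ρ).prod|
          ≤ m * p * Real.exp (-δ / ξ) := by
  have key : ∀ j, ∃ l : List (Site L → Fin 4), l.length ≤ m ∧ (l.map pauliWeight).sum ≤ m ∧
      (∀ Q ∈ l, ∀ i, Q i ≠ 0 → i ∈ box (m * δ) a) ∧
      ∀ ρ, TranslationInvariant ρ → HasECP ξ ρ →
        |pauliExp (P j) ρ - (l.map fun Q => pauliExp Q ρ).prod| ≤ m * Real.exp (-δ / ξ) := by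
    intro j
    obtain ⟨l, hl1, hl2, hl3, hl4⟩ :=
      exists_list_abs_pauliExp_sub_le hξ hδ (pauliWeight (P j)) (P j) rfl (hP j)
    choose! b hb using hl3
    -- Each factor has its own box and its own translation to the common box at a. Moving the
    -- factors independently is allowed because each is a separate expectation value.
    refine ⟨l.map fun Q => shiftString (a - b Q) Q, ?_, ?_, ?_, ?_⟩
    · rw [List.length_map]
      exact hl1.trans (hP j)
    · rw [List.map_map]
      refine le_of_eq_of_le ?_ (hl2.le.trans (hP j))
      congr 1
      exact List.map_congr_left fun Q _ => pauliWeight_shiftString _ Q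
    · intro Q hQ i hi
      obtain ⟨Q', hQ', rfl⟩ := List.mem_map.1 hQ
      have := add_mem_box (hb Q' hQ' _ hi) (a - b Q')
      simpa using this
    · intro ρ hT hE
      rw [List.map_map]
      have : l.map ((fun Q => pauliExp Q ρ) ∘ fun Q => shiftString (a - b Q) Q)
          = l.map fun Q => pauliExp Q ρ :=
        List.map_congr_left fun Q _ => pauliExp_shiftString hT _ Q
      rw [this]
      refine (hl4 ρ hE).trans ?_
      gcongr
      exact hP j
  choose l hl1 hl2 hl3 hl4 using key
  refine ⟨(List.ofFn l).flatten, ?_, ?_, ?_, ?_⟩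
  · rw [List.length_flatten, List.map_ofFn, List.sum_ofFn]
    refine (Finset.sum_le_sum fun j _ => hl1 j).trans ?_
    simp [mul_comm]
  · rw [List.map_flatten, List.sum_flatten, List.map_map, List.map_ofFn, List.sum_ofFn]
    refine (Finset.sum_le_sum fun j _ => hl2 j).trans ?_
    simp [mul_comm]
  · intro Q hQ
    obtain ⟨l', hl', hQ'⟩ := List.mem_flatten.1 hQ
    obtain ⟨j, rfl⟩ := (List.mem_ofFn' _ _).1 hl'
    exact ⟨(List.le_sum_of_mem (List.mem_map_of_mem hQ')).trans (hl2 j), hl3 j Q hQ'⟩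
  · intro ρ hT hE
    rw [List.map_flatten, List.prod_flatten, List.map_map, List.map_ofFn, List.prod_ofFn]
    refine (abs_prod_sub_prod_le _ (fun j => abs_pauliExp_le_one _ ρ)
      fun j => abs_list_prod_pauliExp_le_one _ ρ).trans ?_
    refine (Finset.sum_le_sum fun j _ => hl4 j ρ hT hE).trans ?_
    simp only [Finset.sum_const, Finset.card_univ, Fintype.card_fin, nsmul_eq_mul]
    apply le_of_eq
    ring

end ClusterDecomposition

end GLQK

namespace GLQK

/-! ### Feature expansion of the truncated shadow kernel -/

/-- Cauchy–Schwarz with weights |c i|; applied to the coefficients of g, it produces the factor ‖g‖₁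
in the norm and loss bounds. -/
theorem sq_sum_mul_le {ι : Type} (s : Finset ι) (c b : ι → ℝ) :
    (∑ i ∈ s, c i * b i) ^ 2 ≤ (∑ i ∈ s, |c i|) * ∑ i ∈ s, |c i| * b i ^ 2 := by
  refine Finset.sum_sq_le_sum_mul_sum_of_sq_le_mul s (fun i _ => abs_nonneg _)
    (fun i _ => by positivity) fun i _ => le_of_eq ?_
  rw [mul_pow, ← sq_abs (c i)]
  ring

section ExpKernel

variable {X Λ : Type} [Fintype X] [Fintype Λ]

/-- The d-th power of the kernel has the d-tuples of labels as features, so its quadratic form is a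
weighted sum of squares. -/
theorem sum_pow_kernel_eq (W : Λ → ℝ) (e : Λ → X → ℝ) (a : X → ℝ) (d : ℕ) :
    ∑ x, ∑ y, a x * a y * (∑ q, W q * e q x * e q y) ^ d
      = ∑ q : Fin d → Λ, (∏ j, W (q j)) * (∑ x, a x * ∏ j, e (q j) x) ^ 2 := by
  have h1 : ∀ x y, a x * a y * (∑ q, W q * e q x * e q y) ^ d
      = ∑ q : Fin d → Λ, (∏ j, W (q j)) * ((a x * ∏ j, e (q j) x) * (a y * ∏ j, e (q j) y)) := by
    intro x y
    rw [Fintype.sum_pow, Finset.mul_sum]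
    refine Finset.sum_congr rfl fun q _ => ?_
    rw [Finset.prod_mul_distrib, Finset.prod_mul_distrib]
    ring
  have h2 : ∀ x, ∑ y, a x * a y * (∑ q, W q * e q x * e q y) ^ d = ∑ q : Fin d → Λ,
      ∑ y, (∏ j, W (q j)) * ((a x * ∏ j, e (q j) x) * (a y * ∏ j, e (q j) y)) := by
    intro x
    rw [Finset.sum_comm]
    exact Finset.sum_congr rfl fun y _ => h1 x y
  rw [Finset.sum_congr rfl fun x _ => h2 x, Finset.sum_comm]
  refine Finset.sum_congr rfl fun q _ => ?_
  rw [sq, Finset.sum_mul_sum, Finset.mul_sum]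
  exact Finset.sum_congr rfl fun x _ => (Finset.mul_sum _ _ _).symm

/-- Every monomial in the features is controlled by the exponential kernel. -/
theorem monomial_le_exp_kernel {W : Λ → ℝ} (hW : ∀ q, 0 ≤ W q) (e : Λ → X → ℝ) {τ : ℝ}
    (hτ : 0 ≤ τ) (a : X → ℝ) (l : List Λ) :
    τ ^ l.length / (l.length.factorial : ℝ) * (l.map W).prod
        * (∑ x, a x * (l.map fun q => e q x).prod) ^ 2
      ≤ ∑ x, ∑ y, a x * a y * Real.exp (τ * ∑ q, W q * e q x * e q y) := by
  have hsum : HasSum (fun d : ℕ => τ ^ d / (d.factorial : ℝ)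
      * ∑ x, ∑ y, a x * a y * (∑ q, W q * e q x * e q y) ^ d)
      (∑ x, ∑ y, a x * a y * Real.exp (τ * ∑ q, W q * e q x * e q y)) := by
    simp only [Finset.mul_sum (s := (Finset.univ : Finset X))]
    refine hasSum_sum fun x _ => hasSum_sum fun y _ => ?_
    have h := (NormedSpace.expSeries_div_hasSum_exp (τ * ∑ q, W q * e q x * e q y)).mul_left
      (a x * a y)
    rw [← Real.exp_eq_exp_ℝ] at h
    refine h.congr_fun fun d => ?_
    rw [mul_pow]
    ring
  simp only [sum_pow_kernel_eq] at hsum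
  have hnn : ∀ (d : ℕ) (q : Fin d → Λ),
      0 ≤ (∏ j, W (q j)) * (∑ x, a x * ∏ j, e (q j) x) ^ 2 := fun d q =>
    mul_nonneg (Finset.prod_nonneg fun j _ => hW _) (sq_nonneg _)
  -- All terms of the series are nonnegative. Only the degree of l is kept, and below only the tuple
  -- l itself.
  have h1 := le_hasSum hsum l.length fun d _ =>
    mul_nonneg (by positivity) (Finset.sum_nonneg fun q _ => hnn d q)
  refine le_trans ?_ h1
  rw [mul_assoc]
  refine mul_le_mul_of_nonneg_left ?_ (by positivity)
  have h2 := Finset.single_le_sum (fun q _ => hnn l.length q) (Finset.mem_univ l.get)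
  refine le_of_eq_of_le ?_ h2
  have h3 : ∀ f : Λ → ℝ, (l.map f).prod = ∏ j : Fin l.length, f (l.get j) := fun f => by
    rw [← List.prod_ofFn]
    conv_lhs => rw [← List.ofFn_get l, List.map_ofFn]
    rfl
  simp only [h3]

end ExpKernel

end GLQK

namespace GLQK

open scoped RealInnerProductSpace

/-! ### Feature maps of kernels on finite sets -/

section FiniteKernel

variable {X : Type} [Fintype X] {k : X → X → ℝ}

-- The Gram matrix factors as BᵀB, and the features are the columns of B.
open scoped MatrixOrder in
theorem exists_featureMap (hsymm : ∀ x y, k x y = k y x)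
    (hpos : ∀ a : X → ℝ, 0 ≤ ∑ x, ∑ y, a x * a y * k x y) :
    ∃ φ : X → EuclideanSpace ℝ X, ∀ x y, k x y = ⟪φ x, φ y⟫ := by
  classical
  set K : Matrix X X ℝ := Matrix.of k with hK
  have hPSD : K.PosSemidef := by
    refine Matrix.PosSemidef.of_dotProduct_mulVec_nonneg ?_ fun a => ?_
    · ext x y
      simpa [hK] using hsymm y x
    · refine (hpos a).trans_eq ?_
      simp only [dotProduct, Matrix.mulVec, hK, Matrix.of_apply, Finset.mul_sum, star_trivial]
      exact Finset.sum_congr rfl fun x _ => Finset.sum_congr rfl fun y _ => by ring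
  obtain ⟨B, hB⟩ := CStarAlgebra.nonneg_iff_eq_star_mul_self.mp hPSD.nonneg
  refine ⟨fun x => WithLp.toLp 2 fun i => B i x, fun x y => ?_⟩
  have : k x y = K x y := rfl
  rw [this, hB]
  simp only [Matrix.mul_apply, Matrix.star_apply, star_trivial, PiLp.inner_apply,
    RCLike.inner_apply, conj_trivial]
  exact Finset.sum_congr rfl fun i _ => mul_comm _ _

/-- Any a in the null space of the Gram matrix has ∑ a f = 0 by the hypothesis, so f lies in the row
space and f = ∑ b x • k x. Taking a = b gives q² ≤ C q for the squared norm q of f, hence q ≤ C. -/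
theorem exists_kernel_expansion (hsymm : ∀ x y, k x y = k y x) {f : X → ℝ} {C : ℝ} (hC : 0 ≤ C)
    (h : ∀ a : X → ℝ, (∑ x, a x * f x) ^ 2 ≤ C * ∑ x, ∑ y, a x * a y * k x y) :
    ∃ b : X → ℝ, (∀ y, f y = ∑ x, b x * k x y) ∧ ∑ x, ∑ y, b x * b y * k x y ≤ C := by
  classical
  set ℓ : (X → ℝ) → ((X → ℝ) →ₗ[ℝ] ℝ) := fun w => ∑ x, w x • LinearMap.proj x with hℓ
  have hℓa : ∀ w a, ℓ w a = ∑ x, w x * a x := fun w a => by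
    simp [hℓ, LinearMap.sum_apply]
  have hmem : ℓ f ∈ Submodule.span ℝ (Set.range fun x => ℓ (k x)) := by
    refine mem_span_of_iInf_ker_le_ker fun a ha => ?_
    simp only [Submodule.mem_iInf, LinearMap.mem_ker, hℓa] at ha ⊢
    have h0 : ∑ x, ∑ y, a x * a y * k x y = 0 := by
      refine Finset.sum_eq_zero fun x _ => ?_
      have : ∑ y, a x * a y * k x y = a x * ∑ y, k x y * a y := by
        rw [Finset.mul_sum]
        exact Finset.sum_congr rfl fun y _ => by ring
      rw [this, ha x, mul_zero]
    have h1 := h a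
    rw [h0, mul_zero] at h1
    have h2 := pow_eq_zero_iff (two_ne_zero) |>.1 (le_antisymm h1 (sq_nonneg _))
    rw [← h2]
    exact Finset.sum_congr rfl fun x _ => mul_comm _ _
  obtain ⟨b, hb⟩ := (Submodule.mem_span_range_iff_exists_fun ℝ).1 hmem
  have hf : ∀ y, f y = ∑ x, b x * k x y := fun y => by
    have := LinearMap.congr_fun hb (Pi.single y 1)
    simp only [LinearMap.sum_apply, LinearMap.smul_apply, hℓa, smul_eq_mul] at this
    simpa [Pi.single_apply] using this.symm
  refine ⟨b, hf, ?_⟩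
  have h1 := h b
  have h2 : ∑ x, b x * f x = ∑ x, ∑ y, b x * b y * k x y := by
    refine Finset.sum_congr rfl fun x _ => ?_
    rw [hf x, Finset.mul_sum]
    exact Finset.sum_congr rfl fun y _ => by rw [hsymm x y]; ring
  rw [h2] at h1
  by_contra! hlt
  nlinarith

/-- A function whose evaluation functional is bounded by the quadratic form of a kernel is
represented by a vector in feature space. -/
theorem exists_featureMap_and_dual (hsymm : ∀ x y, k x y = k y x)
    (hpos : ∀ a : X → ℝ, 0 ≤ ∑ x, ∑ y, a x * a y * k x y) {f : X → ℝ} {C : ℝ} (hC : 0 ≤ C)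
    (h : ∀ a : X → ℝ, (∑ x, a x * f x) ^ 2 ≤ C * ∑ x, ∑ y, a x * a y * k x y) :
    ∃ (φ : X → EuclideanSpace ℝ X) (v : EuclideanSpace ℝ X),
      (∀ x y, k x y = ⟪φ x, φ y⟫) ∧ ‖v‖ ^ 2 ≤ C ∧ ∀ x, ⟪v, φ x⟫ = f x := by
  obtain ⟨φ, hφ⟩ := exists_featureMap hsymm hpos
  obtain ⟨b, hb, hbC⟩ := exists_kernel_expansion hsymm hC h
  refine ⟨φ, ∑ x, b x • φ x, hφ, ?_, fun y => ?_⟩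
  · rw [← real_inner_self_eq_norm_sq]
    refine le_of_eq_of_le ?_ hbC
    simp only [sum_inner, inner_sum, real_inner_smul_left, real_inner_smul_right, ← hφ]
    exact Finset.sum_congr rfl fun x _ => Finset.sum_congr rfl fun y _ => by rw [hsymm]; ring
  · simp only [sum_inner, real_inner_smul_left, ← hφ, hb]

end FiniteKernel

end GLQK

namespace GLQK

/-! ### Pauli expansion and norm bounds for the truncated shadow kernel -/

section ShadowKernel

variable {V : Type} [Fintype V] {T : ℕ}

/-- The estimate of `tr(P ρ)` from a classical shadow. -/
noncomputable def shadowEst (P : V → Fin 4) (S : Shadow V T) : ℝ :=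
  1 / (T : ℝ) * ∑ t, shotEst P (S t)

/-- The coefficient of the Pauli string `Q` in the feature expansion on the subsystem `A`. -/
noncomputable def featureWeight [DecidableEq V] (A : Finset V) (g : ℝ) (Q : V → Fin 4) : ℝ :=
  ∏ i, if i ∈ A then (if Q i = 0 then 1 + g / 2 else g / 2) else if Q i = 0 then 1 else 0

theorem featureWeight_nonneg [DecidableEq V] (A : Finset V) {g : ℝ} (hg : 0 ≤ g)
    (Q : V → Fin 4) : 0 ≤ featureWeight A g Q := by
  refine Finset.prod_nonneg fun i _ => ?_
  split_ifs <;> positivity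

/-- Each non-identity letter contributes g/2 ≥ u, each identity letter at least 1. -/
theorem pow_pauliWeight_le_featureWeight [DecidableEq V] {A : Finset V} {g u : ℝ} (hu : 0 ≤ u)
    (hug : u ≤ g / 2) {Q : V → Fin 4} (hQ : ∀ i, Q i ≠ 0 → i ∈ A) :
    u ^ pauliWeight Q ≤ featureWeight A g Q := by
  have h1 : u ^ pauliWeight Q = ∏ i, if Q i = 0 then 1 else u := by
    rw [Finset.prod_ite]
    simp [pauliWeight]
  rw [h1]
  refine Finset.prod_le_prod (fun i _ => by split_ifs <;> positivity) fun i _ => ?_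
  by_cases h : Q i = 0
  · by_cases hA : i ∈ A
    · simp only [h, hA, if_true]
      linarith
    · simp [h, hA]
  · simpa [h, hQ i h] using hug

/-- Each factor expands over the four letters of its site. Outside A only the identity letter has
nonzero weight, so the sum may run over strings on all of V. -/
theorem prod_shadowKernel_eq [DecidableEq V] (A : Finset V) (g : ℝ) (s s' : Shot V) :
    ∏ i ∈ A, (1 + g * (Matrix.trace (localShadow (s i) * localShadow (s' i))).re)
      = ∑ Q : V → Fin 4, featureWeight A g Q * shotEst Q s * shotEst Q s' := by
  have h1 : ∀ i, (∑ q : Fin 4,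
      (if i ∈ A then (if q = 0 then 1 + g / 2 else g / 2) else if q = 0 then 1 else 0)
        * localEst q (s i) * localEst q (s' i))
      = if i ∈ A then 1 + g * (Matrix.trace (localShadow (s i) * localShadow (s' i))).re
        else 1 := by
    intro i
    by_cases hi : i ∈ A
    · simp only [hi, if_true, trace_localShadow_mul, Fin.sum_univ_succ, localEst_zero,
        Fin.succ_ne_zero, if_false, Fin.sum_univ_zero]
      ring
    · simp only [hi, if_false, Fin.sum_univ_succ, localEst_zero, Fin.succ_ne_zero, if_true]
      simp
  have h2 : ∏ i ∈ A, (1 + g * (Matrix.trace (localShadow (s i) * localShadow (s' i))).re)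
      = ∏ i, if i ∈ A then 1 + g * (Matrix.trace (localShadow (s i) * localShadow (s' i))).re
        else 1 := by
    rw [Finset.prod_ite_mem, Finset.univ_inter]
  rw [h2]
  simp only [featureWeight, shotEst, ← Finset.prod_mul_distrib, ← h1]
  rw [Finset.prod_univ_sum, Fintype.piFinset_univ]

theorem truncatedShadowKernel_eq [DecidableEq V] (τ γ : ℝ) (A : Finset V) (S S' : Shadow V T) :
    truncatedShadowKernel τ γ A S S' = Real.exp (τ * ∑ Q : V → Fin 4,
      featureWeight A (γ / (A.card : ℝ)) Q * shadowEst Q S * shadowEst Q S') := by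
  rw [truncatedShadowKernel]
  congr 1
  rw [div_eq_mul_inv, mul_assoc]
  congr 1
  simp only [prod_shadowKernel_eq]
  rw [Finset.sum_congr rfl fun t _ => Finset.sum_comm, Finset.sum_comm, Finset.mul_sum]
  refine Finset.sum_congr rfl fun Q _ => ?_
  simp only [shadowEst]
  have : ∑ t, ∑ t', featureWeight A (γ / (A.card : ℝ)) Q * shotEst Q (S t) * shotEst Q (S' t')
      = featureWeight A (γ / (A.card : ℝ)) Q * ((∑ t, shotEst Q (S t)) * ∑ t, shotEst Q (S' t)) := by
    rw [Finset.sum_mul_sum, Finset.mul_sum]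
    refine Finset.sum_congr rfl fun t _ => ?_
    rw [Finset.mul_sum]
    exact Finset.sum_congr rfl fun t' _ => by ring
  rw [this]
  ring

theorem truncatedShadowKernel_comm (τ γ : ℝ) (A : Finset V) (S S' : Shadow V T) :
    truncatedShadowKernel τ γ A S S' = truncatedShadowKernel τ γ A S' S := by
  classical
  simp only [truncatedShadowKernel_eq, mul_assoc, mul_comm (shadowEst _ S)]

/-- The extreme case is an equal basis and outcome, with value (1 + 9)/2; this is the 5 in exp(5γ).
-/
theorem abs_trace_localShadow_mul_le (r r' : Fin 3 × Bool) :
    |(Matrix.trace (localShadow r * localShadow r')).re| ≤ 5 := by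
  rw [trace_localShadow_mul, Fin.sum_univ_succ]
  simp only [localEst_zero, localEst_succ]
  have h : |∑ w : Fin 3, (if w = r.1 then 3 * sgn r.2 else 0)
      * (if w = r'.1 then 3 * sgn r'.2 else 0)| ≤ 9 := by
    rw [Finset.sum_eq_single r.1 (fun w _ hw => by simp [hw]) (by simp), if_pos rfl]
    split_ifs
    · rw [abs_mul, abs_mul, abs_mul, abs_sgn, abs_sgn]
      norm_num
    · simp
  have := abs_le.1 h
  rw [abs_le]
  constructor <;> linarith

-- The normalization by |A| gives (1 + 5γ/|A|)^|A| ≤ exp(5γ), uniformly in the size of the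
-- subsystem.
omit [Fintype V] in
theorem truncatedShadowKernel_le {τ γ : ℝ} (hτ : 0 ≤ τ) (hγ : 0 ≤ γ) {A : Finset V}
    (hA : A.Nonempty) (hT : 0 < T) (S S' : Shadow V T) :
    truncatedShadowKernel τ γ A S S' ≤ Real.exp (τ * Real.exp (5 * γ)) := by
  have hAc : (0 : ℝ) < A.card := by exact_mod_cast hA.card_pos
  have hT' : (0 : ℝ) < T := by exact_mod_cast hT
  have h1 : ∀ t t', ∏ i ∈ A, (1 + γ / (A.card : ℝ)
      * (Matrix.trace (localShadow (S t i) * localShadow (S' t' i))).re) ≤ Real.exp (5 * γ) := by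
    intro t t'
    refine (le_abs_self _).trans ?_
    rw [Finset.abs_prod]
    calc _ ≤ ∏ _i ∈ A, Real.exp (5 * γ / A.card) := by
          refine Finset.prod_le_prod (fun _ _ => abs_nonneg _) fun i _ => ?_
          refine (abs_add_le _ _).trans ?_
          rw [abs_one, abs_mul, abs_of_nonneg (by positivity : 0 ≤ γ / (A.card : ℝ))]
          refine le_trans ?_ (Real.add_one_le_exp _)
          have := mul_le_mul_of_nonneg_left
            (abs_trace_localShadow_mul_le (S t i) (S' t' i)) (by positivity : 0 ≤ γ / (A.card : ℝ))
          have e : 5 * γ / (A.card : ℝ) = γ / A.card * 5 := by ring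
          linarith
      _ = Real.exp (5 * γ) := by
          rw [Finset.prod_const, ← Real.exp_nat_mul]
          congr 1
          field_simp
  rw [truncatedShadowKernel]
  refine Real.exp_le_exp.2 ?_
  calc _ ≤ τ / (T : ℝ) ^ 2 * ∑ _t : Fin T, ∑ _t' : Fin T, Real.exp (5 * γ) := by
        gcongr with t _ t' _
        exact h1 t t'
    _ = τ * Real.exp (5 * γ) := by
        simp only [Finset.sum_const, Finset.card_univ, Fintype.card_fin, nsmul_eq_mul]
        field_simp

theorem prod_map_ge_pow {Λ : Type} {u : ℝ} (hu : 0 ≤ u) {f : Λ → ℝ} {w : Λ → ℕ} {l : List Λ}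
    (h : ∀ q ∈ l, u ^ w q ≤ f q) : u ^ (l.map w).sum ≤ (l.map f).prod := by
  induction l with
  | nil => simp
  | cons q l ih =>
    rw [List.map_cons, List.map_cons, List.sum_cons, List.prod_cons, pow_add]
    have h1 := h q List.mem_cons_self
    have h2 := ih fun q' hq' => h q' (List.mem_cons_of_mem _ hq')
    exact mul_le_mul h1 h2 (by positivity) ((pow_nonneg hu _).trans h1)

/-- Monomials in the estimates of local Pauli strings have bounded norm in the feature space of the
truncated shadow kernel. -/
theorem monomial_le_truncatedShadowKernel [DecidableEq V] {τ γ s : ℝ} (hτ : 0 < τ) (hγ : 0 < γ)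
    {A : Finset V} (hA : A.Nonempty) (hs : (A.card : ℝ) ≤ s) (hsγ : 1 ≤ 2 * s / γ) {M : ℕ}
    (hM : 1 ≤ (M : ℝ) / τ) {l : List (V → Fin 4)} (hl : l.length ≤ M)
    (hw : (l.map pauliWeight).sum ≤ M) (hsupp : ∀ Q ∈ l, ∀ i, Q i ≠ 0 → i ∈ A)
    (a : Shadow V T → ℝ) :
    (∑ S, a S * (l.map fun Q => shadowEst Q S).prod) ^ 2
      ≤ (2 * M * s / (τ * γ)) ^ M
        * ∑ S, ∑ S', a S * a S' * truncatedShadowKernel τ γ A S S' := by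
  have hAc : (0 : ℝ) < A.card := by exact_mod_cast hA.card_pos
  have hs0 : 0 < s := hAc.trans_le hs
  have hM0 : (0 : ℝ) < M := by
    by_contra! h
    have := div_nonpos_of_nonpos_of_nonneg h hτ.le
    linarith
  have hMτ : τ ≤ M := (one_le_div hτ).1 hM
  have h1 := monomial_le_exp_kernel (X := Shadow V T)
    (featureWeight_nonneg A (g := γ / (A.card : ℝ)) (by positivity))
    (fun Q S => shadowEst Q S) hτ.le a l
  simp only [← truncatedShadowKernel_eq] at h1
  set q := ∑ S, ∑ S', a S * a S' * truncatedShadowKernel τ γ A S S'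
  set x := (∑ S, a S * (l.map fun Q => shadowEst Q S).prod) ^ 2 with hx
  have hx0 : 0 ≤ x := sq_nonneg _
  -- Since γ/(2s) ≤ 1, the total weight may be raised to M.
  have hW : (γ / (2 * s)) ^ M ≤ (l.map (featureWeight A (γ / (A.card : ℝ)))).prod := by
    refine le_trans (pow_le_pow_of_le_one (by positivity) ?_ hw)
      (prod_map_ge_pow (by positivity) fun Q hQ =>
        pow_pauliWeight_le_featureWeight (by positivity) ?_ (hsupp Q hQ))
    · rw [div_le_one (by positivity)]
      rwa [one_le_div hγ] at hsγ
    · rw [div_div, mul_comm (A.card : ℝ)]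
      gcongr
  -- Likewise τ/M ≤ 1 allows raising the degree d to M, and d! ≤ d^d ≤ M^d.
  have hτd : (τ / M) ^ M ≤ τ ^ l.length / (l.length.factorial : ℝ) := by
    calc (τ / M) ^ M ≤ (τ / M) ^ l.length :=
          pow_le_pow_of_le_one (by positivity) ((div_le_one hM0).2 hMτ) hl
      _ = τ ^ l.length / (M : ℝ) ^ l.length := div_pow _ _ _
      _ ≤ τ ^ l.length / (l.length.factorial : ℝ) := by
          gcongr
          exact_mod_cast (Nat.factorial_le_pow l.length).trans (Nat.pow_le_pow_left hl _)
  have h2 : (τ / M) ^ M * (γ / (2 * s)) ^ M * x ≤ q := by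
    refine le_trans ?_ h1
    gcongr
  have h3 : (2 * M * s / (τ * γ)) ^ M * ((τ / M) ^ M * (γ / (2 * s)) ^ M) = 1 := by
    rw [← mul_pow, ← mul_pow]
    have : 2 * M * s / (τ * γ) * (τ / M * (γ / (2 * s))) = 1 := by field_simp
    rw [this, one_pow]
  calc x = (2 * M * s / (τ * γ)) ^ M * ((τ / M) ^ M * (γ / (2 * s)) ^ M * x) := by
        rw [← mul_assoc, h3, one_mul]
    _ ≤ _ := by gcongr

/-- The empty monomial already bounds the quadratic form below by (∑ a)². -/
theorem truncatedShadowKernel_quadratic_nonneg [DecidableEq V] {τ γ : ℝ} (hτ : 0 ≤ τ) (hγ : 0 ≤ γ)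
    (A : Finset V) (a : Shadow V T → ℝ) :
    0 ≤ ∑ S, ∑ S', a S * a S' * truncatedShadowKernel τ γ A S S' := by
  have h1 := monomial_le_exp_kernel (X := Shadow V T)
    (featureWeight_nonneg A (g := γ / (A.card : ℝ)) (by positivity))
    (fun Q S => shadowEst Q S) hτ a []
  simp only [← truncatedShadowKernel_eq] at h1
  refine le_trans ?_ h1
  simp only [List.length_nil, List.map_nil, List.prod_nil]
  positivity

end ShadowKernel

/-! ### The averaged kernel and the norm of the local model -/

section LocalKernel

variable {D : ℕ} {L : Fin D → ℕ} [∀ μ, NeZero (L μ)] {T : ℕ} {τ γ ζ : ℝ}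

theorem polyGLQK_comm (S S' : Shadow (Site L) T) :
    polyGLQK ζ τ γ 1 S S' = polyGLQK ζ τ γ 1 S' S := by
  simp only [polyGLQK, truncatedShadowKernel_comm τ γ _ S S']

theorem localSubsystems_card_pos (L : Fin D → ℕ) [∀ μ, NeZero (L μ)] (ζ : ℝ) :
    0 < (localSubsystems L ζ).card :=
  (Finset.univ_nonempty.image _).card_pos

theorem nonempty_of_mem_localSubsystems (hζ : 0 < ζ) {A : Finset (Site L)}
    (hA : A ∈ localSubsystems L ζ) : A.Nonempty := by
  obtain ⟨a, -, rfl⟩ := Finset.mem_image.1 hA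
  exact ⟨a, self_mem_box hζ a⟩

theorem polyGLQK_le (hτ : 0 ≤ τ) (hγ : 0 ≤ γ) (hζ : 0 < ζ) (hT : 0 < T)
    (S S' : Shadow (Site L) T) : polyGLQK ζ τ γ 1 S S' ≤ Real.exp (τ * Real.exp (5 * γ)) := by
  have hc : (0 : ℝ) < (localSubsystems L ζ).card := by
    exact_mod_cast localSubsystems_card_pos L ζ
  rw [polyGLQK, pow_one, one_div, inv_mul_le_iff₀ hc]
  refine (Finset.sum_le_card_nsmul _ _ _ fun A hA => truncatedShadowKernel_le hτ hγ
    (nonempty_of_mem_localSubsystems hζ hA) hT S S').trans_eq ?_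
  rw [nsmul_eq_mul]

theorem sum_polyGLQK_eq (a : Shadow (Site L) T → ℝ) :
    ∑ S, ∑ S', a S * a S' * polyGLQK ζ τ γ 1 S S'
      = 1 / ((localSubsystems L ζ).card : ℝ) * ∑ A ∈ localSubsystems L ζ,
        ∑ S, ∑ S', a S * a S' * truncatedShadowKernel τ γ A S S' := by
  have h : ∀ S S', a S * a S' * polyGLQK ζ τ γ 1 S S' = ∑ A ∈ localSubsystems L ζ,
      1 / ((localSubsystems L ζ).card : ℝ) * (a S * a S' * truncatedShadowKernel τ γ A S S') := by
    intro S S'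
    rw [polyGLQK, pow_one, Finset.mul_sum, Finset.mul_sum]
    exact Finset.sum_congr rfl fun A _ => by ring
  simp only [h]
  have h2 : ∀ S, ∑ S', ∑ A ∈ localSubsystems L ζ, 1 / ((localSubsystems L ζ).card : ℝ)
        * (a S * a S' * truncatedShadowKernel τ γ A S S')
      = ∑ A ∈ localSubsystems L ζ, 1 / ((localSubsystems L ζ).card : ℝ)
        * ∑ S', a S * a S' * truncatedShadowKernel τ γ A S S' := fun S => by
    rw [Finset.sum_comm]
    exact Finset.sum_congr rfl fun A _ => (Finset.mul_sum _ _ _).symm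
  rw [Finset.sum_congr rfl fun S _ => h2 S, Finset.sum_comm, Finset.mul_sum]
  exact Finset.sum_congr rfl fun A _ => (Finset.mul_sum _ _ _).symm

theorem polyGLQK_quadratic_nonneg (hτ : 0 ≤ τ) (hγ : 0 ≤ γ) (a : Shadow (Site L) T → ℝ) :
    0 ≤ ∑ S, ∑ S', a S * a S' * polyGLQK ζ τ γ 1 S S' := by
  rw [sum_polyGLQK_eq]
  exact mul_nonneg (by positivity) (Finset.sum_nonneg fun A _ =>
    truncatedShadowKernel_quadratic_nonneg hτ hγ A a)

/-- The local model: the average over the local subsystems `A` of the polynomials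
`∑ i, c i * ∏ (Q ∈ l A i), est_Q`. -/
noncomputable def localModel {ι : Type} [Fintype ι] (ζ : ℝ) (c : ι → ℝ)
    (l : Finset (Site L) → ι → List (Site L → Fin 4)) (S : Shadow (Site L) T) : ℝ :=
  1 / ((localSubsystems L ζ).card : ℝ) * ∑ A ∈ localSubsystems L ζ,
    ∑ i, c i * ((l A i).map fun Q => shadowEst Q S).prod

theorem sq_average_le {κ : Type} (s : Finset κ) (hs : s.Nonempty) (f : κ → ℝ) :
    (1 / (s.card : ℝ) * ∑ i ∈ s, f i) ^ 2 ≤ 1 / (s.card : ℝ) * ∑ i ∈ s, f i ^ 2 := by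
  have h := sq_sum_mul_le s (fun _ => 1 / (s.card : ℝ)) f
  have hc : (0 : ℝ) < s.card := by exact_mod_cast hs.card_pos
  rw [Finset.sum_const, abs_of_nonneg (by positivity), nsmul_eq_mul, mul_one_div_cancel hc.ne',
    one_mul, ← Finset.mul_sum, ← Finset.mul_sum] at h
  exact h

/-- Jensen over the boxes and Cauchy–Schwarz over the terms of g reduce the bound to single
monomials. Each is compared with the kernel of its own box, so the average over boxes reassembles
the full kernel with no loss in the number of boxes. -/
theorem localModel_le_polyGLQK {ι : Type} [Fintype ι] (hτ : 0 < τ) (hγ : 0 < γ) (hζ : 0 < ζ)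
    {s : ℝ} (hs : (⌈ζ⌉₊ : ℝ) ^ D ≤ s) (hsγ : 1 ≤ 2 * s / γ) {M : ℕ} (hM : 1 ≤ (M : ℝ) / τ)
    (c : ι → ℝ) {l : Finset (Site L) → ι → List (Site L → Fin 4)}
    (hl : ∀ A ∈ localSubsystems L ζ, ∀ i, (l A i).length ≤ M ∧
      ((l A i).map pauliWeight).sum ≤ M ∧ ∀ Q ∈ l A i, ∀ j, Q j ≠ 0 → j ∈ A)
    (a : Shadow (Site L) T → ℝ) :
    (∑ S, a S * localModel ζ c l S) ^ 2
      ≤ coeffNorm c ^ 2 * (2 * M * s / (τ * γ)) ^ M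
        * ∑ S, ∑ S', a S * a S' * polyGLQK ζ τ γ 1 S S' := by
  have hne : (localSubsystems L ζ).Nonempty := Finset.card_pos.1 (localSubsystems_card_pos L ζ)
  set b : Finset (Site L) → ι → ℝ :=
    fun A i => ∑ S, a S * ((l A i).map fun Q => shadowEst Q S).prod with hb
  have h1 : ∑ S, a S * localModel ζ c l S = 1 / ((localSubsystems L ζ).card : ℝ)
      * ∑ A ∈ localSubsystems L ζ, ∑ i, c i * b A i := by
    have h : ∀ S, a S * localModel ζ c l S = 1 / ((localSubsystems L ζ).card : ℝ)
        * ∑ A ∈ localSubsystems L ζ,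
          ∑ i, c i * (a S * ((l A i).map fun Q => shadowEst Q S).prod) := by
      intro S
      rw [localModel, mul_left_comm, Finset.mul_sum]
      congr 1
      refine Finset.sum_congr rfl fun A _ => ?_
      rw [Finset.mul_sum]
      exact Finset.sum_congr rfl fun i _ => by ring
    simp only [h]
    rw [← Finset.mul_sum, Finset.sum_comm]
    congr 1
    refine Finset.sum_congr rfl fun A _ => ?_
    rw [Finset.sum_comm]
    exact Finset.sum_congr rfl fun i _ => (Finset.mul_sum _ _ _).symm
  rw [h1, sum_polyGLQK_eq]
  refine (sq_average_le _ hne _).trans ?_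
  rw [mul_left_comm]
  refine mul_le_mul_of_nonneg_left ?_ (by positivity)
  rw [Finset.mul_sum]
  refine Finset.sum_le_sum fun A hA => ?_
  have hcard : (A.card : ℝ) ≤ s := by
    obtain ⟨a₀, -, rfl⟩ := Finset.mem_image.1 hA
    refine le_trans ?_ hs
    exact_mod_cast card_box_le ζ a₀
  refine (sq_sum_mul_le _ c (b A)).trans ?_
  rw [sq (coeffNorm c), mul_assoc, mul_assoc]
  have hc0 : 0 ≤ coeffNorm c := Finset.sum_nonneg fun i _ => abs_nonneg (c i)
  change coeffNorm c * _ ≤ _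
  refine mul_le_mul_of_nonneg_left ?_ hc0
  rw [coeffNorm, Finset.sum_mul]
  refine Finset.sum_le_sum fun i _ => mul_le_mul_of_nonneg_left ?_ (abs_nonneg _)
  exact monomial_le_truncatedShadowKernel hτ hγ (nonempty_of_mem_localSubsystems hζ hA) hcard hsγ
    hM (hl A hA i).1 (hl A hA i).2.1 (hl A hA i).2.2 a

end LocalKernel

end GLQK

namespace GLQK

/-! ### Concentration of classical shadows -/

section Hoeffding

variable {Ω : Type} [Fintype Ω]

/-- On [-tc, tc] the convex exponential lies below its chord. -/
theorem exp_mul_le_cosh_add_sinh {c x : ℝ} (hc : 0 < c) (hx : |x| ≤ c) (t : ℝ) :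
    Real.exp (t * x) ≤ Real.cosh (t * c) + x / c * Real.sinh (t * c) := by
  have hx' := abs_le.1 hx
  have ha : 0 ≤ (1 - x / c) / 2 := by
    have := (div_le_one hc).2 hx'.2
    linarith
  have hb : 0 ≤ (1 + x / c) / 2 := by
    have : -1 ≤ x / c := by
      rw [le_div_iff₀ hc]
      linarith
    linarith
  have h := convexOn_exp.2 (Set.mem_univ (-(t * c))) (Set.mem_univ (t * c)) ha hb (by ring)
  simp only [smul_eq_mul] at h
  have e1 : (1 - x / c) / 2 * -(t * c) + (1 + x / c) / 2 * (t * c) = t * x := by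
    field_simp
    ring
  rw [e1] at h
  refine h.trans_eq ?_
  rw [Real.cosh_eq, Real.sinh_eq]
  ring

/-- The zero mean kills the sinh term of the chord bound, and cosh x ≤ exp(x²/2). -/
theorem sum_mul_exp_le {p f : Ω → ℝ} (hp : ∀ s, 0 ≤ p s) (hp1 : ∑ s, p s = 1) {c : ℝ}
    (hc : 0 < c) (hf : ∀ s, |f s| ≤ c) (hf0 : ∑ s, p s * f s = 0) (t : ℝ) :
    ∑ s, p s * Real.exp (t * f s) ≤ Real.exp ((t * c) ^ 2 / 2) := by
  calc ∑ s, p s * Real.exp (t * f s)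
      ≤ ∑ s, p s * (Real.cosh (t * c) + f s / c * Real.sinh (t * c)) :=
        Finset.sum_le_sum fun s _ =>
          mul_le_mul_of_nonneg_left (exp_mul_le_cosh_add_sinh hc (hf s) t) (hp s)
    _ = (∑ s, p s) * Real.cosh (t * c) + (∑ s, p s * f s) * (Real.sinh (t * c) / c) := by
        rw [Finset.sum_mul, Finset.sum_mul, ← Finset.sum_add_distrib]
        exact Finset.sum_congr rfl fun s _ => by ring
    _ = Real.cosh (t * c) := by rw [hp1, hf0]; ring
    _ ≤ _ := Real.cosh_le_exp_half_sq _

theorem sum_prod_eq_one {p : Ω → ℝ} (hp1 : ∑ s, p s = 1) (T : ℕ) :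
    ∑ S : Fin T → Ω, ∏ t, p (S t) = 1 := by
  rw [← Fintype.sum_pow, hp1, one_pow]

/-- One-sided Hoeffding bound for a product of finite distributions. -/
theorem sum_prod_tail_le {p f : Ω → ℝ} (hp : ∀ s, 0 ≤ p s) (hp1 : ∑ s, p s = 1) {c : ℝ}
    (hc : 0 < c) (hf : ∀ s, |f s| ≤ c) (hf0 : ∑ s, p s * f s = 0) {T : ℕ} (hT : 0 < T) {η : ℝ}
    (hη : 0 < η) :
    ∑ S : Fin T → Ω, (∏ t, p (S t)) * (if η < 1 / (T : ℝ) * ∑ t, f (S t) then 1 else 0)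
      ≤ Real.exp (-(T * η ^ 2 / (2 * c ^ 2))) := by
  have hT' : (0 : ℝ) < T := by exact_mod_cast hT
  -- This θ minimizes the exponent T(θ²c²/2 - θη) of the Chernoff bound.
  set θ := η / c ^ 2 with hθ
  have hθ0 : 0 < θ := by positivity
  calc ∑ S : Fin T → Ω, (∏ t, p (S t)) * (if η < 1 / (T : ℝ) * ∑ t, f (S t) then 1 else 0)
      ≤ ∑ S : Fin T → Ω, (∏ t, p (S t)) * Real.exp (θ * (∑ t, f (S t) - T * η)) := by
        refine Finset.sum_le_sum fun S _ =>
          mul_le_mul_of_nonneg_left ?_ (Finset.prod_nonneg fun t _ => hp _)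
        split_ifs with h
        · rw [one_div, inv_mul_eq_div, lt_div_iff₀ hT'] at h
          refine Real.one_le_exp (mul_nonneg hθ0.le ?_)
          linarith
        · positivity
    _ = Real.exp (-(θ * (T * η))) * (∑ s, p s * Real.exp (θ * f s)) ^ T := by
        rw [Fintype.sum_pow, Finset.mul_sum]
        refine Finset.sum_congr rfl fun S _ => ?_
        rw [Finset.prod_mul_distrib, ← Real.exp_sum, ← Finset.mul_sum, mul_left_comm, ← Real.exp_add]
        congr 2
        ring
    _ ≤ Real.exp (-(θ * (T * η))) * Real.exp ((θ * c) ^ 2 / 2) ^ T := by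
        gcongr
        · exact Finset.sum_nonneg fun s _ => mul_nonneg (hp s) (Real.exp_nonneg _)
        · exact sum_mul_exp_le hp hp1 hc hf hf0 θ
    _ = Real.exp (-(T * η ^ 2 / (2 * c ^ 2))) := by
        rw [← Real.exp_nat_mul, ← Real.exp_add, hθ]
        congr 1
        field_simp
        ring

/-- Hoeffding's inequality for a product of finite distributions. -/
theorem sum_prod_abs_tail_le {p f : Ω → ℝ} (hp : ∀ s, 0 ≤ p s) (hp1 : ∑ s, p s = 1) {c : ℝ}
    (hc : 0 < c) (hf : ∀ s, |f s| ≤ c) (hf0 : ∑ s, p s * f s = 0) {T : ℕ} (hT : 0 < T) {η : ℝ}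
    (hη : 0 < η) :
    ∑ S : Fin T → Ω, (∏ t, p (S t)) * (if η < |1 / (T : ℝ) * ∑ t, f (S t)| then 1 else 0)
      ≤ 2 * Real.exp (-(T * η ^ 2 / (2 * c ^ 2))) := by
  have h1 := sum_prod_tail_le hp hp1 hc hf hf0 hT hη
  have h2 := sum_prod_tail_le (f := fun s => -f s) hp hp1 hc (fun s => by rw [abs_neg]; exact hf s)
    (by simp [hf0]) hT hη
  rw [two_mul]
  refine le_trans ?_ (add_le_add h1 h2)
  rw [← Finset.sum_add_distrib]
  refine Finset.sum_le_sum fun S _ => ?_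
  rw [← mul_add]
  refine mul_le_mul_of_nonneg_left ?_ (Finset.prod_nonneg fun t _ => hp _)
  have e : 1 / (T : ℝ) * ∑ t, -f (S t) = -(1 / (T : ℝ) * ∑ t, f (S t)) := by
    rw [Finset.sum_neg_distrib, mul_neg]
  rw [e]
  by_cases h : η < |1 / (T : ℝ) * ∑ t, f (S t)|
  · rw [if_pos h]
    rcases lt_abs.1 h with h' | h'
    · rw [if_pos h']
      split_ifs <;> norm_num
    · rw [if_pos h']
      split_ifs <;> norm_num
  · rw [if_neg h]
    split_ifs <;> norm_num

end Hoeffding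

/-! ### Mean squared error of products of shadow estimates -/

section ShadowConcentration

variable {V : Type} [Fintype V] [DecidableEq V] {T : ℕ}

theorem shadowProb_nonneg (ρ : QState V) (S : Shadow V T) : 0 ≤ shadowProb ρ S :=
  Finset.prod_nonneg fun _ _ => shotProb_nonneg ρ _

theorem sum_shadowProb (ρ : QState V) : ∑ S : Shadow V T, shadowProb ρ S = 1 :=
  sum_prod_eq_one (sum_shotProb ρ) T

theorem sum_shadowProb_tail_le (ρ : QState V) {m : ℕ} (hm : 1 ≤ m) {Q : V → Fin 4}
    (hQ : pauliWeight Q ≤ m) (hT : 0 < T) {η : ℝ} (hη : 0 < η) :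
    ∑ S : Shadow V T, shadowProb ρ S * (if η < |shadowEst Q S - pauliExp Q ρ| then 1 else 0)
      ≤ 2 * Real.exp (-(T * η ^ 2 / (2 * (4 / 3 * 3 ^ m) ^ 2))) := by
  have hT' : (T : ℝ) ≠ 0 := by exact_mod_cast hT.ne'
  have h3 : (3 : ℝ) ≤ 3 ^ m := by
    calc (3 : ℝ) = 3 ^ 1 := (pow_one _).symm
      _ ≤ 3 ^ m := pow_le_pow_right₀ (by norm_num) hm
  -- The centred estimate is at most 3^m + 1, and 1 ≤ 3^m/3 because m ≥ 1.
  have hf : ∀ s, |shotEst Q s - pauliExp Q ρ| ≤ 4 / 3 * 3 ^ m := fun s => by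
    have h1 := abs_sub (shotEst Q s) (pauliExp Q ρ)
    have h2 := abs_shotEst_le Q s
    have h4 : (3 : ℝ) ^ pauliWeight Q ≤ 3 ^ m := pow_le_pow_right₀ (by norm_num) hQ
    have h5 := abs_pauliExp_le_one Q ρ
    linarith
  have hf0 : ∑ s, shotProb ρ s * (shotEst Q s - pauliExp Q ρ) = 0 := by
    simp only [mul_sub]
    rw [Finset.sum_sub_distrib, sum_shotProb_mul_shotEst, ← Finset.sum_mul, sum_shotProb, one_mul,
      sub_self]
  have h := sum_prod_abs_tail_le (shotProb_nonneg ρ) (sum_shotProb ρ) (by positivity) hf hf0 hT hη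
  have e : ∀ S : Shadow V T, shadowEst Q S - pauliExp Q ρ
      = 1 / (T : ℝ) * ∑ t, (shotEst Q (S t) - pauliExp Q ρ) := fun S => by
    rw [shadowEst, Finset.sum_sub_distrib, mul_sub]
    simp [hT']
  simp only [e]
  exact h

omit [DecidableEq V] in
theorem abs_shadowEst_le (Q : V → Fin 4) (S : Shadow V T) :
    |shadowEst Q S| ≤ 3 ^ pauliWeight Q := by
  rw [shadowEst, abs_mul, abs_of_nonneg (by positivity : (0 : ℝ) ≤ 1 / T)]
  rcases Nat.eq_zero_or_pos T with rfl | hT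
  · simp
  have hT' : (0 : ℝ) < T := by exact_mod_cast hT
  rw [one_div, inv_mul_le_iff₀ hT']
  refine (Finset.abs_sum_le_sum_abs _ _).trans
    ((Finset.sum_le_sum fun t _ => abs_shotEst_le Q (S t)).trans_eq ?_)
  simp

omit [DecidableEq V] in
theorem abs_prod_shadowEst_le (l : List (V → Fin 4)) (S : Shadow V T) :
    |(l.map fun Q => shadowEst Q S).prod| ≤ 3 ^ (l.map pauliWeight).sum := by
  induction l with
  | nil => simp
  | cons Q l ih =>
    rw [List.map_cons, List.map_cons, List.prod_cons, List.sum_cons, abs_mul, pow_add]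
    exact mul_le_mul (abs_shadowEst_le Q S) ih (abs_nonneg _) (by positivity)

theorem abs_list_prod_sub_le {Λ : Type} {η : ℝ} (hη : 0 ≤ η) {e μ : Λ → ℝ} {l : List Λ}
    (he : ∀ q ∈ l, |e q - μ q| ≤ η) (hμ : ∀ q ∈ l, |μ q| ≤ 1) :
    |(l.map e).prod| ≤ (1 + η) ^ l.length ∧
      |(l.map e).prod - (l.map μ).prod| ≤ (1 + η) ^ l.length - 1 := by
  induction l with
  | nil => simp
  | cons q l ih =>
    obtain ⟨h1, h2⟩ := ih (fun q' hq' => he q' (List.mem_cons_of_mem _ hq'))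
      fun q' hq' => hμ q' (List.mem_cons_of_mem _ hq')
    have he' := he q List.mem_cons_self
    have hμ' := hμ q List.mem_cons_self
    have h3 : |e q| ≤ 1 + η := by
      have := abs_add_le (e q - μ q) (μ q)
      rw [sub_add_cancel] at this
      linarith
    rw [List.map_cons, List.map_cons, List.prod_cons, List.prod_cons, List.length_cons]
    set x := (l.map e).prod
    set y := (l.map μ).prod
    constructor
    · rw [abs_mul, pow_succ']
      exact mul_le_mul h3 h1 (abs_nonneg _) (by positivity)
    · calc |e q * x - μ q * y| = |(e q - μ q) * x + μ q * (x - y)| := by ring_nf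
        _ ≤ |e q - μ q| * |x| + |μ q| * |x - y| := by
          rw [← abs_mul, ← abs_mul]
          exact abs_add_le _ _
        _ ≤ η * (1 + η) ^ l.length + 1 * ((1 + η) ^ l.length - 1) := by gcongr
        _ = (1 + η) ^ (l.length + 1) - 1 := by ring

theorem exists_mem_le_sum_indicator {Λ : Type} {b : Λ → Prop} [DecidablePred b] {l : List Λ}
    (h : ∃ q ∈ l, b q) : (1 : ℝ) ≤ (l.map fun q => if b q then (1 : ℝ) else 0).sum := by
  obtain ⟨q, hq, hb⟩ := h
  have := List.single_le_sum (l := l.map fun q => if b q then (1 : ℝ) else 0) (fun x hx => by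
    obtain ⟨q, -, rfl⟩ := List.mem_map.1 hx
    split_ifs <;> norm_num) 1 (List.mem_map.2 ⟨q, hq, if_pos hb⟩)
  exact this

/-- The mean squared error of a product of shadow estimates. -/
theorem sum_shadowProb_sq_le (ρ : QState V) {m M : ℕ} (hm : 1 ≤ m) (hT : 0 < T) {η : ℝ}
    (hη : 0 < η) {l : List (V → Fin 4)} (hlen : l.length ≤ M) (hsum : (l.map pauliWeight).sum ≤ M)
    (hl : ∀ Q ∈ l, pauliWeight Q ≤ m) :
    ∑ S : Shadow V T, shadowProb ρ S
        * ((l.map fun Q => shadowEst Q S).prod - (l.map fun Q => pauliExp Q ρ).prod) ^ 2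
      ≤ (Real.exp (M * η) - 1) ^ 2
        + (3 ^ M + 1) ^ 2 * (M * (2 * Real.exp (-(T * η ^ 2 / (2 * (4 / 3 * 3 ^ m) ^ 2))))) := by
  set bad : Shadow V T → (V → Fin 4) → ℝ :=
    fun S Q => if η < |shadowEst Q S - pauliExp Q ρ| then 1 else 0 with hbad
  have hbad0 : ∀ S Q, 0 ≤ bad S Q := fun S Q => by
    simp only [hbad]
    split_ifs <;> norm_num
  -- If some estimate is off by more than η, the deterministic bound 3^M + 1 is paid once per bad
  -- factor; otherwise the error is at most (1 + η)^d - 1 for d factors.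
  have hpt : ∀ S : Shadow V T,
      ((l.map fun Q => shadowEst Q S).prod - (l.map fun Q => pauliExp Q ρ).prod) ^ 2
        ≤ (Real.exp (M * η) - 1) ^ 2 + (3 ^ M + 1) ^ 2 * (l.map fun Q => bad S Q).sum := by
    intro S
    by_cases h : ∃ Q ∈ l, η < |shadowEst Q S - pauliExp Q ρ|
    · have h1 := exists_mem_le_sum_indicator h
      have h2 : |(l.map fun Q => shadowEst Q S).prod - (l.map fun Q => pauliExp Q ρ).prod|
          ≤ 3 ^ M + 1 := by
        refine (abs_sub _ _).trans (add_le_add ((abs_prod_shadowEst_le l S).trans ?_) ?_)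
        · exact pow_le_pow_right₀ (by norm_num) hsum
        · have := (abs_list_prod_sub_le le_rfl (e := fun Q => pauliExp Q ρ)
            (μ := fun Q => pauliExp Q ρ) (l := l) (by simp)
            fun Q _ => abs_pauliExp_le_one Q ρ).1
          simpa using this
      have h3 := pow_le_pow_left₀ (abs_nonneg _) h2 2
      rw [sq_abs] at h3
      have h4 : ((3 : ℝ) ^ M + 1) ^ 2 * 1 ≤ (3 ^ M + 1) ^ 2 * (l.map fun Q => bad S Q).sum :=
        mul_le_mul_of_nonneg_left h1 (by positivity)
      nlinarith [sq_nonneg (Real.exp (M * η) - 1)]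
    · push Not at h
      have h1 := (abs_list_prod_sub_le hη.le h fun Q _ => abs_pauliExp_le_one Q ρ).2
      have h2 : (1 + η) ^ l.length ≤ Real.exp (M * η) := by
        calc (1 + η) ^ l.length ≤ (1 + η) ^ M := pow_le_pow_right₀ (by linarith) hlen
          _ ≤ Real.exp η ^ M := by
            gcongr
            linarith [Real.add_one_le_exp η]
          _ = Real.exp (M * η) := (Real.exp_nat_mul _ _).symm
      have h3 := pow_le_pow_left₀ (abs_nonneg _) (h1.trans (sub_le_sub_right h2 1)) 2
      rw [sq_abs] at h3
      have h4 : 0 ≤ (l.map fun Q => bad S Q).sum := List.sum_nonneg fun x hx => by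
        obtain ⟨Q, -, rfl⟩ := List.mem_map.1 hx
        exact hbad0 S Q
      have : 0 ≤ ((3 : ℝ) ^ M + 1) ^ 2 * (l.map fun Q => bad S Q).sum := by positivity
      linarith
  set K := 2 * Real.exp (-(T * η ^ 2 / (2 * (4 / 3 * 3 ^ m) ^ 2)))
  have hlist : ∀ l' : List (V → Fin 4), (∀ Q ∈ l', pauliWeight Q ≤ m) →
      ∑ S : Shadow V T, shadowProb ρ S * (l'.map fun Q => bad S Q).sum ≤ l'.length * K := by
    intro l' hl'
    induction l' with
    | nil => simp
    | cons Q l' ih =>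
      have h1 := sum_shadowProb_tail_le ρ hm (hl' Q List.mem_cons_self) hT hη
      have h2 := ih fun Q' hQ' => hl' Q' (List.mem_cons_of_mem _ hQ')
      simp only [List.map_cons, List.sum_cons, mul_add, Finset.sum_add_distrib, List.length_cons]
      push_cast
      linarith
  calc _ ≤ ∑ S : Shadow V T, shadowProb ρ S * ((Real.exp (M * η) - 1) ^ 2
        + (3 ^ M + 1) ^ 2 * (l.map fun Q => bad S Q).sum) :=
        Finset.sum_le_sum fun S _ => mul_le_mul_of_nonneg_left (hpt S) (shadowProb_nonneg ρ S)
    _ = (∑ S : Shadow V T, shadowProb ρ S) * (Real.exp (M * η) - 1) ^ 2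
        + (3 ^ M + 1) ^ 2 * ∑ S : Shadow V T, shadowProb ρ S * (l.map fun Q => bad S Q).sum := by
        rw [Finset.sum_mul, Finset.mul_sum, ← Finset.sum_add_distrib]
        exact Finset.sum_congr rfl fun S _ => by ring
    _ ≤ _ := by
        rw [sum_shadowProb, one_mul]
        have h1 := hlist l hl
        have h2 : (l.length : ℝ) * K ≤ M * K := by gcongr
        have := mul_le_mul_of_nonneg_left (h1.trans h2) (by positivity : 0 ≤ ((3 : ℝ) ^ M + 1) ^ 2)
        linarith

theorem exp_sub_one_sq_le {x : ℝ} (h0 : 0 ≤ x) (h1 : x ≤ 1 / 5) :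
    (Real.exp x - 1) ^ 2 ≤ (6 / 5 * x) ^ 2 := by
  have h2 := abs_le.1 (Real.abs_exp_sub_one_sub_id_le (x := x) (by rw [abs_of_nonneg h0]; linarith))
  refine pow_le_pow_left₀ (by linarith [Real.add_one_le_exp x]) ?_ 2
  nlinarith

/-- With the shadow size of the theorem, the mean squared error of a product of shadow estimates
is small. -/
theorem sum_shadowProb_sq_le_of_size (ρ : QState V) {m p : ℕ} (hm : 1 ≤ m) (hp : 1 ≤ p)
    (hT : 0 < T) {ε G : ℝ} (hε : 0 < ε) (hεG : ε < G)
    (hTlog : 256 / (3 * ε ^ 2) * G ^ 2 * 12 ^ m * (m * p : ℝ) ^ 2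
        * Real.log (G ^ 2 * 2 ^ (m + 5) * (m * p) * (3 ^ (m ^ 2 * p) + 1) ^ 2 / ε ^ 2) ≤ (T : ℝ))
    {l : List (V → Fin 4)} (hlen : l.length ≤ m * p) (hsum : (l.map pauliWeight).sum ≤ m * p)
    (hl : ∀ Q ∈ l, pauliWeight Q ≤ m) :
    ∑ S : Shadow V T, shadowProb ρ S
        * ((l.map fun Q => shadowEst Q S).prod - (l.map fun Q => pauliExp Q ρ).prod) ^ 2
      ≤ 1 / 10 * (ε / G) ^ 2 := by
  have hG : 0 < G := hε.trans hεG
  have hm' : (1 : ℝ) ≤ m := by exact_mod_cast hm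
  have hp' : (1 : ℝ) ≤ p := by exact_mod_cast hp
  set M : ℕ := m * p with hM
  have hMc : (M : ℝ) = m * p := by rw [hM, Nat.cast_mul]
  have hM1 : (1 : ℝ) ≤ M := by
    rw [hMc]
    nlinarith
  rw [← hMc] at hTlog
  set x := ε / G with hx
  have hx0 : 0 < x := by positivity
  have hx1 : x ≤ 1 := (div_le_one hG).2 hεG.le
  set Λ := G ^ 2 * 2 ^ (m + 5) * M * (3 ^ (m ^ 2 * p) + 1) ^ 2 / ε ^ 2 with hΛ
  have hΛ0 : 0 < Λ := by positivity
  have hpow : (3 : ℝ) ^ M ≤ 3 ^ (m ^ 2 * p) := by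
    refine pow_le_pow_right₀ (by norm_num) ?_
    rw [hM, sq]
    exact Nat.mul_le_mul_right p (Nat.le_mul_of_pos_left m hm)
  have h2m : (2 : ℝ) ≤ 2 ^ m := by
    calc (2 : ℝ) = 2 ^ 1 := (pow_one _).symm
      _ ≤ 2 ^ m := pow_le_pow_right₀ (by norm_num) hm
  -- 32 · 2^m ≥ 64, and mp ≤ m²p in the exponent of 3.
  have hΛlow : 64 * M * (3 ^ M + 1) ^ 2 / x ^ 2 ≤ Λ := by
    have e : Λ = 2 ^ m * 32 * M * (3 ^ (m ^ 2 * p) + 1) ^ 2 / x ^ 2 := by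
      rw [hΛ, hx, pow_add]
      field_simp
      norm_num
    rw [e]
    gcongr
    linarith
  have hΛ1 : 1 ≤ Λ := by
    refine le_trans ?_ hΛlow
    rw [le_div_iff₀ (by positivity)]
    have : (1 : ℝ) ≤ (3 ^ M + 1) ^ 2 := one_le_pow₀ (by linarith [pow_pos (zero_lt_three' ℝ) M])
    nlinarith
  have hlog : 0 ≤ Real.log Λ := Real.log_nonneg hΛ1
  -- With Mη = x/5 the good event contributes at most (6x/25)² and the bad one x²/32; together they
  -- stay below x²/10.
  set η := x / (5 * M) with hη
  have hη0 : 0 < η := by positivity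
  have h := sum_shadowProb_sq_le ρ hm hT hη0 hlen hsum hl
  have e1 : (M : ℝ) * η = x / 5 := by
    rw [hη]
    field_simp
  rw [e1] at h
  have h1 : (Real.exp (x / 5) - 1) ^ 2 ≤ (6 / 5 * (x / 5)) ^ 2 :=
    exp_sub_one_sq_le (by positivity) (by linarith)
  -- Splitting 12^m = (4/3)^m 9^m, the claim becomes (256/75)(4/3)^m ≥ 32/9, which holds for m ≥ 1.
  have hexp : Real.log Λ ≤ T * η ^ 2 / (2 * (4 / 3 * 3 ^ m) ^ 2) := by
    rw [le_div_iff₀ (by positivity)]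
    have h43 : (4 / 3 : ℝ) ≤ (4 / 3) ^ m := by
      calc (4 / 3 : ℝ) = (4 / 3) ^ 1 := (pow_one _).symm
        _ ≤ (4 / 3) ^ m := pow_le_pow_right₀ (by norm_num) hm
    have e12 : (12 : ℝ) ^ m = (4 / 3) ^ m * (3 ^ m) ^ 2 := by
      rw [← pow_mul, mul_comm m 2, pow_mul, ← mul_pow]
      norm_num
    have e2 : 256 / (3 * ε ^ 2) * G ^ 2 * 12 ^ m * (M : ℝ) ^ 2 * Real.log Λ * η ^ 2
        = 256 / 75 * (4 / 3) ^ m * ((3 ^ m) ^ 2 * Real.log Λ) := by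
      rw [e12, hη, hx]
      field_simp
      ring
    have h2 := mul_le_mul_of_nonneg_right hTlog (sq_nonneg η)
    rw [e2] at h2
    refine le_trans ?_ h2
    have h3 : 0 ≤ ((3 : ℝ) ^ m) ^ 2 * Real.log Λ := by positivity
    nlinarith
  have h2 : Real.exp (-(T * η ^ 2 / (2 * (4 / 3 * 3 ^ m) ^ 2))) ≤ Λ⁻¹ := by
    conv_rhs => rw [← Real.exp_log hΛ0, ← Real.exp_neg]
    refine Real.exp_le_exp.2 (neg_le_neg ?_)
    exact hexp
  have h3 : (3 ^ M + 1) ^ 2 * (M * (2 * Real.exp (-(T * η ^ 2 / (2 * (4 / 3 * 3 ^ m) ^ 2)))))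
      ≤ x ^ 2 / 32 := by
    calc _ ≤ ((3 : ℝ) ^ M + 1) ^ 2 * (M * (2 * (64 * M * (3 ^ M + 1) ^ 2 / x ^ 2)⁻¹)) := by
          gcongr
          exact h2.trans (inv_anti₀ (by positivity) hΛlow)
      _ = x ^ 2 / 32 := by
          field_simp
          norm_num
  refine h.trans ((add_le_add h1 h3).trans ?_)
  nlinarith [sq_nonneg x]

end ShadowConcentration

end GLQK

namespace GLQK

open scoped RealInnerProductSpace

/-! ### The law of labelled classical shadows -/

section DataDistribution

variable {V : Type} [Fintype V] [DecidableEq V] {T p : ℕ} {ι : Type} [Fintype ι]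
  (c : ι → ℝ) (P : ι → Fin p → V → Fin 4)

theorem lintegral_labelledShadow (ρ : QState V) {f : Shadow V T × ℝ → ENNReal}
    (hf : Measurable f) :
    ∫⁻ z, f z ∂(labelledShadow T c P ρ)
      = ∑ S : Shadow V T, ENNReal.ofReal (shadowProb ρ S) * f (S, polyVal c P ρ) := by
  change ∫⁻ z, f z ∂(∑ S : Shadow V T,
    ENNReal.ofReal (shadowProb ρ S) • Measure.dirac (S, polyVal c P ρ)) = _
  rw [lintegral_finsetSum_measure]
  refine Finset.sum_congr rfl fun S _ => ?_
  rw [lintegral_smul_measure, lintegral_dirac' _ hf, smul_eq_mul]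

theorem sum_ofReal_shadowProb (ρ : QState V) :
    ∑ S : Shadow V T, ENNReal.ofReal (shadowProb ρ S) = 1 := by
  rw [← ENNReal.ofReal_sum_of_nonneg fun S _ => shadowProb_nonneg ρ S, sum_shadowProb,
    ENNReal.ofReal_one]

theorem lintegral_dataDist (𝒟 : Measure (QState V)) {f : Shadow V T × ℝ → ENNReal}
    (hf : Measurable f) :
    ∫⁻ z, f z ∂(dataDist 𝒟 T c P)
      = ∫⁻ ρ, ∑ S : Shadow V T, ENNReal.ofReal (shadowProb ρ S) * f (S, polyVal c P ρ) ∂𝒟 := by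
  rw [dataDist, Measure.lintegral_bind (labelledShadow T c P).measurable.aemeasurable
    hf.aemeasurable]
  simp only [lintegral_labelledShadow c P _ hf]

theorem isProbabilityMeasure_dataDist (𝒟 : Measure (QState V)) [IsProbabilityMeasure 𝒟] :
    IsProbabilityMeasure (dataDist 𝒟 T c P) := by
  constructor
  rw [← lintegral_one, lintegral_dataDist c P 𝒟 measurable_const]
  simp [sum_ofReal_shadowProb]

theorem abs_polyVal_le (ρ : QState V) : |polyVal c P ρ| ≤ coeffNorm c := by
  refine (Finset.abs_sum_le_sum_abs _ _).trans (Finset.sum_le_sum fun i _ => ?_)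
  rw [abs_mul, Finset.abs_prod]
  exact mul_le_of_le_one_right (abs_nonneg _)
    (Finset.prod_le_one (fun _ _ => abs_nonneg _) fun j _ => abs_pauliExp_le_one _ ρ)

theorem ae_dataDist_abs_label_le (𝒟 : Measure (QState V)) :
    ∀ᵐ z ∂(dataDist 𝒟 T c P), |z.2| ≤ coeffNorm c := by
  have hs : MeasurableSet {z : Shadow V T × ℝ | ¬|z.2| ≤ coeffNorm c} :=
    (measurableSet_le measurable_snd.abs measurable_const).compl
  rw [ae_iff, ← lintegral_indicator_one hs,
    lintegral_dataDist c P 𝒟 (measurable_one.indicator hs)]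
  simp [Set.indicator, fun ρ => (abs_polyVal_le c P ρ).not_gt]

/-- Passing to the Lebesgue integral of a nonnegative function makes any integrability assumption
unnecessary; a bound for almost every state suffices. -/
theorem integral_dataDist_le (𝒟 : Measure (QState V)) [IsProbabilityMeasure 𝒟]
    {f : Shadow V T × ℝ → ℝ} (hf : Measurable f) (hf0 : ∀ z, 0 ≤ f z) {C : ℝ} (hC : 0 ≤ C)
    (h : ∀ᵐ ρ ∂𝒟, ∑ S : Shadow V T, shadowProb ρ S * f (S, polyVal c P ρ) ≤ C) :
    ∫ z, f z ∂(dataDist 𝒟 T c P) ≤ C := by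
  rw [integral_eq_lintegral_of_nonneg_ae (Filter.Eventually.of_forall hf0)
    hf.aestronglyMeasurable, lintegral_dataDist c P 𝒟 hf.ennreal_ofReal]
  refine ENNReal.toReal_le_of_le_ofReal hC ?_
  calc _ ≤ ∫⁻ _ρ, ENNReal.ofReal C ∂𝒟 := by
        refine lintegral_mono_ae (h.mono fun ρ hρ => ?_)
        simp only [← ENNReal.ofReal_mul (shadowProb_nonneg ρ _)]
        rw [← ENNReal.ofReal_sum_of_nonneg fun S _ =>
          mul_nonneg (shadowProb_nonneg ρ S) (hf0 _)]
        exact ENNReal.ofReal_le_ofReal hρ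
    _ = ENNReal.ofReal C := by simp

end DataDistribution

/-! ### The loss of the local model -/

section LocalModel

variable {D : ℕ} {L : Fin D → ℕ} [∀ μ, NeZero (L μ)] {T m p : ℕ} {ι : Type} [Fintype ι]

theorem sq_average_sum_le (ζ : ℝ) (c : ι → ℝ) (b : Finset (Site L) → ι → ℝ) :
    (1 / ((localSubsystems L ζ).card : ℝ) * ∑ A ∈ localSubsystems L ζ, ∑ i, c i * b A i) ^ 2
      ≤ 1 / ((localSubsystems L ζ).card : ℝ) * ∑ A ∈ localSubsystems L ζ,
        coeffNorm c * ∑ i, |c i| * b A i ^ 2 := by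
  refine (sq_average_le _ (Finset.card_pos.1 (localSubsystems_card_pos L ζ)) _).trans ?_
  gcongr with A _
  exact sq_sum_mul_le _ c (b A)

theorem average_sum_le {ζ : ℝ} {c : ι → ℝ} {b : Finset (Site L) → ι → ℝ} {C : ℝ}
    (h : ∀ A ∈ localSubsystems L ζ, ∀ i, b A i ≤ C) :
    1 / ((localSubsystems L ζ).card : ℝ) * ∑ A ∈ localSubsystems L ζ,
        coeffNorm c * ∑ i, |c i| * b A i ≤ coeffNorm c ^ 2 * C := by
  have hc : (0 : ℝ) < (localSubsystems L ζ).card := by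
    exact_mod_cast localSubsystems_card_pos L ζ
  have hc0 : 0 ≤ coeffNorm c := Finset.sum_nonneg fun i _ => abs_nonneg (c i)
  rw [one_div, inv_mul_le_iff₀ hc]
  refine (Finset.sum_le_card_nsmul _ _ (coeffNorm c ^ 2 * C) fun A hA => ?_).trans_eq
    (nsmul_eq_mul _ _)
  rw [sq, mul_assoc]
  refine mul_le_mul_of_nonneg_left ?_ hc0
  rw [coeffNorm, Finset.sum_mul]
  exact Finset.sum_le_sum fun i _ => mul_le_mul_of_nonneg_left (h A hA i) (abs_nonneg _)

/-- The expected loss of the local model on the shadows of a single state. -/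
theorem sum_shadowProb_localModel_le (ρ : QState (Site L)) {ζ ε κ : ℝ} {c : ι → ℝ}
    {P : ι → Fin p → Site L → Fin 4} {l : Finset (Site L) → ι → List (Site L → Fin 4)}
    (hbias : ∀ A ∈ localSubsystems L ζ, ∀ i, |∏ j, pauliExp (P i j) ρ
      - ((l A i).map fun Q => pauliExp Q ρ).prod| ≤ ε)
    (hvar : ∀ A ∈ localSubsystems L ζ, ∀ i, ∑ S : Shadow (Site L) T, shadowProb ρ S
      * (((l A i).map fun Q => shadowEst Q S).prod
        - ((l A i).map fun Q => pauliExp Q ρ).prod) ^ 2 ≤ κ) :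
    ∑ S : Shadow (Site L) T, shadowProb ρ S * ((polyVal c P ρ - localModel ζ c l S) ^ 2 / 2)
      ≤ coeffNorm c ^ 2 * (ε ^ 2 + κ) := by
  have hc : ((localSubsystems L ζ).card : ℝ) ≠ 0 := by
    exact_mod_cast (localSubsystems_card_pos L ζ).ne'
  set b₁ : Finset (Site L) → ι → ℝ := fun A i => ∏ j, pauliExp (P i j) ρ
    - ((l A i).map fun Q => pauliExp Q ρ).prod with hb₁
  set b₂ : Shadow (Site L) T → Finset (Site L) → ι → ℝ := fun S A i =>
    ((l A i).map fun Q => shadowEst Q S).prod - ((l A i).map fun Q => pauliExp Q ρ).prod with hb₂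
  -- The error splits into the bias from clustering, which does not depend on the shadow, and the
  -- statistical error of the estimates.
  have hdiff : ∀ S : Shadow (Site L) T, polyVal c P ρ - localModel ζ c l S
      = 1 / ((localSubsystems L ζ).card : ℝ) * ∑ A ∈ localSubsystems L ζ, ∑ i, c i * b₁ A i
        - 1 / ((localSubsystems L ζ).card : ℝ)
          * ∑ A ∈ localSubsystems L ζ, ∑ i, c i * b₂ S A i := by
    intro S
    have h1 : polyVal c P ρ = 1 / ((localSubsystems L ζ).card : ℝ)
        * ∑ _A ∈ localSubsystems L ζ, ∑ i, c i * ∏ j, pauliExp (P i j) ρ := by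
      rw [Finset.sum_const, nsmul_eq_mul, ← mul_assoc, one_div_mul_cancel hc, one_mul, polyVal]
    rw [h1, localModel, ← mul_sub, ← mul_sub, ← Finset.sum_sub_distrib,
      ← Finset.sum_sub_distrib]
    congr 1
    refine Finset.sum_congr rfl fun A _ => ?_
    rw [← Finset.sum_sub_distrib, ← Finset.sum_sub_distrib]
    refine Finset.sum_congr rfl fun i _ => ?_
    simp only [hb₁, hb₂]
    ring
  have hpt : ∀ S : Shadow (Site L) T, (polyVal c P ρ - localModel ζ c l S) ^ 2 / 2
      ≤ coeffNorm c ^ 2 * ε ^ 2 + 1 / ((localSubsystems L ζ).card : ℝ)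
        * ∑ A ∈ localSubsystems L ζ, coeffNorm c * ∑ i, |c i| * b₂ S A i ^ 2 := by
    intro S
    have h1 := (sq_average_sum_le ζ c b₁).trans (average_sum_le fun A hA i =>
      (sq_le_sq' (abs_le.1 (hbias A hA i)).1 (abs_le.1 (hbias A hA i)).2))
    have h2 := sq_average_sum_le ζ c (b₂ S)
    rw [hdiff S]
    set x := 1 / ((localSubsystems L ζ).card : ℝ) * ∑ A ∈ localSubsystems L ζ, ∑ i, c i * b₁ A i
    set y := 1 / ((localSubsystems L ζ).card : ℝ)
      * ∑ A ∈ localSubsystems L ζ, ∑ i, c i * b₂ S A i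
    -- (x - y)²/2 ≤ x² + y²: the ½ in the loss absorbs the factor 2.
    nlinarith [sq_nonneg (x + y)]
  calc _ ≤ ∑ S : Shadow (Site L) T, shadowProb ρ S * (coeffNorm c ^ 2 * ε ^ 2
        + 1 / ((localSubsystems L ζ).card : ℝ)
        * ∑ A ∈ localSubsystems L ζ, coeffNorm c * ∑ i, |c i| * b₂ S A i ^ 2) :=
        Finset.sum_le_sum fun S _ => mul_le_mul_of_nonneg_left (hpt S) (shadowProb_nonneg ρ S)
    _ = coeffNorm c ^ 2 * ε ^ 2 + 1 / ((localSubsystems L ζ).card : ℝ)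
        * ∑ A ∈ localSubsystems L ζ, coeffNorm c
          * ∑ i, |c i| * ∑ S : Shadow (Site L) T, shadowProb ρ S * b₂ S A i ^ 2 := by
        simp only [mul_add, Finset.sum_add_distrib, ← Finset.sum_mul, sum_shadowProb, one_mul]
        congr 1
        simp only [Finset.mul_sum]
        rw [Finset.sum_comm]
        refine Finset.sum_congr rfl fun A _ => ?_
        rw [Finset.sum_comm]
        exact Finset.sum_congr rfl fun i _ => Finset.sum_congr rfl fun S _ => by ring
    _ ≤ coeffNorm c ^ 2 * ε ^ 2 + coeffNorm c ^ 2 * κ := by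
        exact add_le_add le_rfl (average_sum_le hvar)
    _ = _ := by ring

omit [Fintype ι] in
/-- The lists of local Pauli strings that approximate the monomials of `g` in each local
subsystem. -/
theorem exists_local_lists {ξ δ : ℝ} (hξ : 0 < ξ) (hδ : 0 < δ)
    (P : ι → Fin p → Site L → Fin 4) (hP : ∀ i j, pauliWeight (P i j) ≤ m) :
    ∃ l : Finset (Site L) → ι → List (Site L → Fin 4),
      ∀ A ∈ localSubsystems L (m * δ), ∀ i, (l A i).length ≤ m * p ∧
        ((l A i).map pauliWeight).sum ≤ m * p ∧
        (∀ Q ∈ l A i, pauliWeight Q ≤ m ∧ ∀ j, Q j ≠ 0 → j ∈ A) ∧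
        ∀ ρ, TranslationInvariant ρ → HasECP ξ ρ →
          |∏ j, pauliExp (P i j) ρ - ((l A i).map fun Q => pauliExp Q ρ).prod|
            ≤ m * p * Real.exp (-δ / ξ) := by
  have h : ∀ (A : Finset (Site L)) (i : ι), ∃ l : List (Site L → Fin 4),
      A ∈ localSubsystems L (m * δ) → l.length ≤ m * p ∧ (l.map pauliWeight).sum ≤ m * p ∧
        (∀ Q ∈ l, pauliWeight Q ≤ m ∧ ∀ j, Q j ≠ 0 → j ∈ A) ∧
        ∀ ρ, TranslationInvariant ρ → HasECP ξ ρ →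
          |∏ j, pauliExp (P i j) ρ - (l.map fun Q => pauliExp Q ρ).prod|
            ≤ m * p * Real.exp (-δ / ξ) := by
    intro A i
    by_cases hA : A ∈ localSubsystems L (m * δ)
    · obtain ⟨a, -, rfl⟩ := Finset.mem_image.1 hA
      obtain ⟨l, hl⟩ := exists_list_supported_in_box hξ hδ (P i) (hP i) a
      exact ⟨l, fun _ => hl⟩
    · exact ⟨[], fun h => absurd h hA⟩
  choose l hl using h
  exact ⟨l, fun A hA i => hl A i hA⟩

end LocalModel

end GLQK

/-! ### Choice of constants and conclusion -/

theorem theorem2 {D : ℕ} (L : Fin D → ℕ) [∀ μ, NeZero (L μ)]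
    -- an `m`-body, degree-`p` polynomial `g`
    (m p : ℕ) {ι : Type} [Fintype ι] (c : ι → ℝ) (P : ι → Fin p → GLQK.Site L → Fin 4)
    (hP : ∀ i j, GLQK.pauliWeight (P i j) ≤ m)
    -- a distribution of translation-invariant states with correlation length at most `ξ`
    (ξ : ℝ) (hξ : 0 < ξ)
    (𝒟 : MeasureTheory.Measure (GLQK.QState (GLQK.Site L)))
    [MeasureTheory.IsProbabilityMeasure 𝒟]
    (h𝒟 : ∀ᵐ ρ ∂𝒟, GLQK.TranslationInvariant ρ ∧ GLQK.HasECP ξ ρ)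
    -- accuracy and hyperparameters
    (ε : ℝ) (hε : 0 < ε) (hεg : ε < GLQK.coeffNorm c)
    (τ γ : ℝ) (hτ : 0 < τ) (hγ : 0 < γ)
    (ζ s Bsq lam : ℝ)
    (hζ : ζ = m * ξ * Real.log (2 * GLQK.coeffNorm c * m * p / ε))
    (hs : s = (⌈ζ⌉₊ : ℝ) ^ D)
    (hsγ : 1 ≤ 2 * s / γ) (hmpτ : 1 ≤ (m * p : ℝ) / τ)
    (hBsq : Bsq = GLQK.coeffNorm c ^ 2 * (2 * m * p * s / (τ * γ)) ^ (m * p))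
    (hlam : lam = ε ^ 2 / (6 * Bsq))
    -- number of training samples and shadow size
    (N T : ℕ)
    (hN : 600 / ε ^ 4 * GLQK.coeffNorm c ^ 4 * Real.exp (τ * Real.exp (5 * γ))
        * (2 * m * p * s / (τ * γ)) ^ (m * p) ≤ (N : ℝ))
    (hT : 256 / (3 * ε ^ 2) * GLQK.coeffNorm c ^ 2 * 12 ^ m * (m * p : ℝ) ^ 2
        * Real.log (GLQK.coeffNorm c ^ 2 * 2 ^ (m + 5) * (m * p) * (3 ^ (m ^ 2 * p) + 1) ^ 2
            / ε ^ 2) ≤ (T : ℝ)) :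
    -- kernel ridge regression has a solution for every training dataset
    (∀ Z : Fin N → GLQK.Shadow (GLQK.Site L) T × ℝ,
      ∃ α, GLQK.IsKRRSolution (GLQK.polyGLQK ζ τ γ 1) lam Bsq Z α) ∧
    -- and every choice of solutions has small expected loss on average over training datasets
    ∀ α : (Fin N → GLQK.Shadow (GLQK.Site L) T × ℝ) → Fin N → ℝ,
      (∀ Z, GLQK.IsKRRSolution (GLQK.polyGLQK ζ τ γ 1) lam Bsq Z (α Z)) →
      (∀ Z, MeasureTheory.Integrable (GLQK.sqLoss (GLQK.polyGLQK ζ τ γ 1) Z (α Z))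
          (GLQK.dataDist 𝒟 T c P)) ∧
      MeasureTheory.Integrable
        (fun Z => GLQK.expectedLoss (GLQK.dataDist 𝒟 T c P) (GLQK.polyGLQK ζ τ γ 1) Z (α Z))
        (MeasureTheory.Measure.pi fun _ : Fin N => GLQK.dataDist 𝒟 T c P) ∧
      ∫ Z, GLQK.expectedLoss (GLQK.dataDist 𝒟 T c P) (GLQK.polyGLQK ζ τ γ 1) Z (α Z)
        ∂(MeasureTheory.Measure.pi fun _ : Fin N => GLQK.dataDist 𝒟 T c P) ≤ ε ^ 2 := by
  classical
  have := GLQK.isProbabilityMeasure_dataDist (T := T) c P 𝒟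
  set G := GLQK.coeffNorm c with hG
  have hG0 : 0 < G := hε.trans hεg
  have hmp : (1 : ℕ) ≤ m * p := by
    by_contra! h
    have h0 : (m * p : ℝ) = 0 := by exact_mod_cast Nat.lt_one_iff.1 h
    rw [h0, zero_div] at hmpτ
    linarith
  have hm : 1 ≤ m := Nat.pos_of_ne_zero fun h => by simp [h] at hmp
  have hp : 1 ≤ p := Nat.pos_of_ne_zero fun h => by simp [h] at hmp
  have hM1 : (1 : ℝ) ≤ m * p := by exact_mod_cast hmp
  have hm0 : (0 : ℝ) < m := by exact_mod_cast hm
  have harg : 1 < 2 * G * m * p / ε := by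
    rw [lt_div_iff₀ hε]
    nlinarith
  set δ := ξ * Real.log (2 * G * m * p / ε) with hδ
  have hδ0 : 0 < δ := mul_pos hξ (Real.log_pos harg)
  have hζδ : ζ = m * δ := by rw [hζ, hδ, mul_assoc]
  have hζ0 : 0 < ζ := by rw [hζδ]; positivity
  have hs0 : 0 < s := by
    by_contra! h
    have : 2 * s / γ ≤ 0 := div_nonpos_of_nonpos_of_nonneg (by linarith) hγ.le
    linarith
  -- δ is chosen so that the bias per monomial is ε/(2G), hence ε/2 after summing against the
  -- coefficients.
  have hexp : (m * p : ℝ) * Real.exp (-δ / ξ) = ε / (2 * G) := by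
    have e : -δ / ξ = -Real.log (2 * G * m * p / ε) := by
      rw [hδ]
      field_simp
    rw [e, Real.exp_neg, Real.exp_log (by linarith)]
    have : (m : ℝ) * p ≠ 0 := by linarith
    field_simp
  set R := (2 * m * p * s / (τ * γ)) ^ (m * p) with hR
  have hR0 : 0 < R := by
    have : (0 : ℝ) < 2 * m * p * s / (τ * γ) := by
      rw [mul_assoc (2 : ℝ)]
      positivity
    positivity
  have hB0 : 0 < Bsq := by rw [hBsq]; positivity
  set β := Real.exp (τ * Real.exp (5 * γ)) with hβ
  have hβ0 : 0 < β := Real.exp_pos _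
  have hN0 : 0 < N := by
    have : (0 : ℝ) < N := lt_of_lt_of_le (by positivity) hN
    exact_mod_cast this
  -- The assumed sample size exceeds what stability requires by the factor G²/ε² ≥ 1.
  have hlamN : 100 * β ≤ lam * N := by
    have h1 : 1 ≤ G ^ 2 / ε ^ 2 := by
      rw [one_le_div (by positivity)]
      gcongr
    calc 100 * β ≤ 100 * β * (G ^ 2 / ε ^ 2) := le_mul_of_one_le_right (by positivity) h1
      _ = lam * (600 / ε ^ 4 * G ^ 4 * β * R) := by
        rw [hlam, hBsq]
        field_simp
        norm_num
      _ ≤ lam * N := by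
        refine mul_le_mul_of_nonneg_left hN ?_
        rw [hlam]
        positivity
  -- The argument of the logarithm exceeds 1, so the lower bound on T is positive.
  have hT0 : 0 < T := by
    have hΛ : 1 < G ^ 2 * 2 ^ (m + 5) * (m * p) * (3 ^ (m ^ 2 * p) + 1) ^ 2 / ε ^ 2 := by
      rw [lt_div_iff₀ (by positivity), one_mul]
      have h1 : (1 : ℝ) ≤ 2 ^ (m + 5) := one_le_pow₀ (by norm_num)
      have h2 : (1 : ℝ) ≤ (3 ^ (m ^ 2 * p) + 1) ^ 2 :=
        one_le_pow₀ (by linarith [pow_pos (zero_lt_three' ℝ) (m ^ 2 * p)])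
      have h3 : (1 : ℝ) ≤ 2 ^ (m + 5) * (m * p) * (3 ^ (m ^ 2 * p) + 1) ^ 2 :=
        one_le_mul_of_one_le_of_one_le (one_le_mul_of_one_le_of_one_le h1 hM1) h2
      calc ε ^ 2 < G ^ 2 := by gcongr
        _ ≤ G ^ 2 * (2 ^ (m + 5) * (m * p) * (3 ^ (m ^ 2 * p) + 1) ^ 2) :=
          le_mul_of_one_le_right (by positivity) h3
        _ = _ := by ring
    have hlog := Real.log_pos hΛ
    have : (0 : ℝ) < T := lt_of_lt_of_le (by positivity) hT
    exact_mod_cast this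
  obtain ⟨l, hl⟩ := GLQK.exists_local_lists (m := m) hξ hδ0 P hP
  rw [← hζδ] at hl
  have hmpτ' : 1 ≤ ((m * p : ℕ) : ℝ) / τ := by exact_mod_cast hmpτ
  have hquad := GLQK.localModel_le_polyGLQK (T := T) hτ hγ hζ0 hs.ge hsγ hmpτ' c
    (l := l) fun A hA i => ⟨(hl A hA i).1, (hl A hA i).2.1,
      fun Q hQ => ((hl A hA i).2.2.1 Q hQ).2⟩
  have hBeq : GLQK.coeffNorm c ^ 2 * (2 * ((m * p : ℕ) : ℝ) * s / (τ * γ)) ^ (m * p) = Bsq := by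
    rw [hBsq, hR, Nat.cast_mul, ← mul_assoc (2 : ℝ)]
  rw [hBeq] at hquad
  obtain ⟨φ, v, hφ, hv, hvf⟩ := GLQK.exists_featureMap_and_dual GLQK.polyGLQK_comm
    (GLQK.polyGLQK_quadratic_nonneg hτ.le hγ.le) hB0.le hquad
  -- 7/20 = 1/4 + 1/10, the squared bias and the mean squared error of the estimates.
  have hloss : ∫ z, GLQK.dualLoss φ v z ∂(GLQK.dataDist 𝒟 T c P) ≤ 7 / 20 * ε ^ 2 := by
    refine GLQK.integral_dataDist_le c P 𝒟 (GLQK.measurable_dualLoss v)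
      (GLQK.dualLoss_nonneg v) (by positivity) (h𝒟.mono fun ρ hρ => ?_)
    simp only [GLQK.dualLoss, hvf]
    refine (GLQK.sum_shadowProb_localModel_le ρ (ε := ε / (2 * G)) (κ := 1 / 10 * (ε / G) ^ 2)
      (fun A hA i => ?_) fun A hA i => ?_).trans_eq ?_
    · rw [← hexp]
      exact (hl A hA i).2.2.2 ρ hρ.1 hρ.2
    · exact GLQK.sum_shadowProb_sq_le_of_size ρ hm hp hT0 hε hεg hT (hl A hA i).1
        (hl A hA i).2.1 fun Q hQ => ((hl A hA i).2.2.1 Q hQ).1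
    · rw [← hG]
      field_simp
      norm_num
  obtain ⟨hex, hbound⟩ := GLQK.kernelRidgeRegression_expectedLoss_le
    (μ := GLQK.dataDist 𝒟 T c P) hφ hβ0
    (fun S => GLQK.polyGLQK_le hτ.le hγ.le hζ0 hT0 S S) hN0 hlamN
    (GLQK.ae_dataDist_abs_label_le c P 𝒟) hv
  refine ⟨hex, fun α hα => ?_⟩
  obtain ⟨h1, h2, h3⟩ := hbound α hα
  refine ⟨h1, h2, h3.trans ?_⟩
  have hreg : lam * ‖v‖ ^ 2 ≤ ε ^ 2 / 6 := by
    calc lam * ‖v‖ ^ 2 ≤ lam * Bsq := by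
          refine mul_le_mul_of_nonneg_left hv ?_
          rw [hlam]
          positivity
      _ = ε ^ 2 / 6 := by
          rw [hlam]
          field_simp
  -- (201/199)²(7/20 + 1/6) is about 0.53.
  nlinarith [sq_nonneg ε]
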